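/- A space of homogeneous type is a triple $(X,\rho,\mu)$, where $\rho$ is a quasimetric on $X$ (non-negative, symmetric, zero exactly on the diagonal, $\rho(x,y)\le K(\rho(x,z)+\rho(z,y))$), and $\mu$ is a Borel measure for which the balls $B(x,r)=\{y:\rho(y,x)<r\}$ are measurable, $0<\mu(B(x,r))<\infty$, and $\mu(B(x,2r))\le C_d\,\mu(B(x,r))$ for all $x\in X$, $r>0$. A dyadic grid on it is a family $\mathcal D=\bigcup_{k\in\mathbb Z}\mathcal D_k$ of measurable sets (cubes), with centers $x_c(Q)$, for which there are constants $C_0>0$ and $0<\eta,\epsilon<1$ such that 1. $X=\bigcup_{Q\in\mathcal D_k}Q$ for every $k$; 2. any two cubes of $\mathcal D$ are disjoint or one contains the other; 3. every $Q_1\in\mathcal D_k$ contains at least one $Q_2\in\mathcal D_{k+1}$ (a child) and is contained in exactly one $Q_3\in\mathcal D_{k-1}$; 4. $\mu(Q_2)\ge\epsilon\,\mu(Q_1)$ if $Q_2$ is a child of $Q_1$; 5. $B(x_c(Q),\eta^k)\subset Q\subset B(x_c(Q),C_0\eta^k)$ for $Q\in\mathcal D_k$. A collection $S\subset\mathcal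 D$ is sparse if there are pairwise disjoint measurable sets $E(Q)\subset Q$, $Q\in S$, with $\mu(Q)\le 2\mu(E(Q))$; the sparse operator is $$T^Sf(x)=\sum_{Q\in S}\Big(\frac1{\mu(Q)}\int_Q f\,d\mu\Big)\chi_Q(x),\qquad f\ge 0 .$$ A weight is a measurable function $w:X\to[0,\infty]$ with $0<w<\infty$ $\mu$-a.e. For a weight $w$ and $g\ge0$ put $$\|g\|_{L^p(w)}=\Big(\int_X g^p\,w\,d\mu\Big)^{1/p},\qquad \|g\|_{L^{p,\infty}(w)}=\sup_{t>0}\,t\,w(\{g>t\})^{1/p},\qquad w(A)=\int_A w\,d\mu .$$ For $Y=L^p(u)$ or $Y=L^{p,\infty}(u)$ let $\|T^S(\cdot\,\sigma)\|_{L^p(\sigma)\to Y}\in[0,\infty]$ be the supremum of $\|T^S(f\sigma)\|_{Y}$ over all measurable $f\ge0$ with $\|f\|_{L^p(\sigma)}\le1$ (as $T^S$ is a positive operator, it suffices to consider non-negative $f$). **Theorem.** Let $(X,\rho,\mu)$ be a space of homogeneous type, $1<p<\infty$ and $\frac1p+\frac1{p'}=1$. There is a constant $C<\infty$, depending only on $(X,\rho,\mu)$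 and $p$, such that for every dyadic grid $\mathcal D$ on $X$, every sparse family $S\subset\mathcal D$, and all weights $u,\sigma$, with $$N=\|T^S(\cdot\,\sigma)\|_{L^p(\sigma)\to L^{p,\infty}(u)}+\|T^S(\cdot\,u)\|_{L^{p'}(u)\to L^{p',\infty}(\sigma)},$$ one has $$\|T^S(\cdot\,\sigma)\|_{L^p(\sigma)\to L^p(u)}\le C\,N\qquad\text{and}\qquad N\le C\,\|T^S(\cdot\,\sigma)\|_{L^p(\sigma)\to L^p(u)} .$$ (Either side may be infinite.) -/

import Mathlib

open MeasureTheory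
open scoped ENNReal NNReal

/-- A quasimetric on `X`: non-negative, vanishing exactly on the diagonal, symmetric, and satisfying
the triangle inequality up to a multiplicative constant. -/
structure IsQuasimetric {X : Type*} (ρ : X → X → ℝ) : Prop where
  nonneg : ∀ x y, 0 ≤ ρ x y
  eq_zero_iff : ∀ x y, ρ x y = 0 ↔ x = y
  symm : ∀ x y, ρ x y = ρ y x
  quasi_triangle : ∃ K : ℝ, ∀ x y z, ρ x y ≤ K * (ρ x z + ρ z y)

/-- The ball `{x : ρ(x, x₀) < r}`. -/
def qball {X : Type*} (ρ : X → X → ℝ) (x₀ : X) (r : ℝ) : Set X := {x | ρ x x₀ < r}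

/-- `(X, ρ, μ)` is a space of homogeneous type: `ρ` is a quasimetric, and `μ` is a doubling measure
for which the open sets of the quasimetric topology and the balls are measurable, and which gives
every ball positive and finite measure. -/
structure IsHomogeneousType {X : Type*} [MeasurableSpace X] (ρ : X → X → ℝ) (μ : Measure X) :
    Prop where
  quasimetric : IsQuasimetric ρ
  measurableSet_open : ∀ U : Set X, (∀ x ∈ U, ∃ r > 0, qball ρ x r ⊆ U) → MeasurableSet U
  measurableSet_ball : ∀ x r, MeasurableSet (qball ρ x r)
  doubling : ∃ Cd : ℝ≥0, ∀ x, ∀ r > 0, μ (qball ρ x (2 * r)) ≤ Cd * μ (qball ρ x r)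
  ball_pos : ∀ x, ∀ r > 0, 0 < μ (qball ρ x r)
  ball_lt_top : ∀ x, ∀ r > 0, μ (qball ρ x r) < ∞

/-- `D = ⋃ k, D k` is a dyadic grid on `(X, ρ, μ)`: `D k` is the collection of dyadic cubes of
generation `k`, and `center k Q` is the centre of the cube `Q`, which has sidelength `η ^ k`. -/
def IsDyadicGrid {X : Type*} [MeasurableSpace X] (ρ : X → X → ℝ) (μ : Measure X)
    (D : ℤ → Set (Set X)) : Prop :=
  ∃ (C η : ℝ) (ε : ℝ≥0) (center : ℤ → Set X → X),
    0 < C ∧ 0 < η ∧ η < 1 ∧ 0 < ε ∧ ε < 1 ∧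
    (∀ k, ∀ Q ∈ D k, MeasurableSet Q) ∧
    -- the cubes of each generation cover the space
    (∀ k, ⋃₀ D k = Set.univ) ∧
    -- two cubes are either disjoint or nested
    (∀ k l, ∀ Q₁ ∈ D k, ∀ Q₂ ∈ D l, Disjoint Q₁ Q₂ ∨ Q₁ ⊆ Q₂ ∨ Q₂ ⊆ Q₁) ∧
    -- each cube has at least one child and exactly one parent
    (∀ k, ∀ Q₁ ∈ D k, (∃ Q₂ ∈ D (k + 1), Q₂ ⊆ Q₁) ∧ (∃! Q₃, Q₃ ∈ D (k - 1) ∧ Q₁ ⊆ Q₃)) ∧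
    -- a child is not much smaller than its parent
    (∀ k, ∀ Q₁ ∈ D k, ∀ Q₂ ∈ D (k + 1), Q₂ ⊆ Q₁ → ε * μ Q₁ ≤ μ Q₂) ∧
    -- a cube is comparable to balls around its centre
    (∀ k, ∀ Q ∈ D k,
      qball ρ (center k Q) (η ^ k) ⊆ Q ∧ Q ⊆ qball ρ (center k Q) (C * η ^ k))

/-- `S` is a sparse family in the dyadic grid `D`. -/
def IsSparseFamily {X : Type*} [MeasurableSpace X] (μ : Measure X) (D : ℤ → Set (Set X))
    (S : Set (Set X)) : Prop :=
  S ⊆ ⋃ k, D k ∧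
  ∃ E : Set X → Set X, S.PairwiseDisjoint E ∧
    ∀ Q ∈ S, MeasurableSet (E Q) ∧ E Q ⊆ Q ∧ μ Q ≤ 2 * μ (E Q)

/-- The sparse operator `T^S f = ∑_{Q ∈ S} (μ(Q)⁻¹ ∫_Q f dμ) χ_Q`, acting on non-negative
functions. -/
noncomputable def sparseOp {X : Type*} [MeasurableSpace X] (μ : Measure X) (S : Set (Set X))
    (f : X → ℝ≥0∞) (x : X) : ℝ≥0∞ :=
  ∑' Q : S, (Q : Set X).indicator (fun _ => ⨍⁻ y in (Q : Set X), f y ∂μ) x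

/-- A weight: a non-negative measurable function which is finite almost everywhere and positive
almost everywhere. -/
def IsWeight {X : Type*} [MeasurableSpace X] (μ : Measure X) (w : X → ℝ≥0∞) : Prop :=
  Measurable w ∧ ∀ᵐ x ∂μ, 0 < w x ∧ w x < ∞

/-- The weighted Lebesgue norm `‖g‖_{L^p(w)} = (∫ g ^ p w dμ) ^ (1/p)`. -/
noncomputable def strongNorm {X : Type*} [MeasurableSpace X] (μ : Measure X) (p : ℝ)
    (w g : X → ℝ≥0∞) : ℝ≥0∞ :=
  eLpNorm g (ENNReal.ofReal p) (μ.withDensity w)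

/-- The weighted weak norm `‖g‖_{L^{p,∞}(w)} = sup_{t > 0} t w({g > t}) ^ (1/p)`. -/
noncomputable def weakNorm {X : Type*} [MeasurableSpace X] (μ : Measure X) (p : ℝ)
    (w g : X → ℝ≥0∞) : ℝ≥0∞ :=
  ⨆ t : ℝ≥0, (t : ℝ≥0∞) * (μ.withDensity w {x | (t : ℝ≥0∞) < g x}) ^ (1 / p)

/-- The norm of `T^S(· σ)` from `L^p(σ)` to `L^p(u)`. -/
noncomputable def strongOpNorm {X : Type*} [MeasurableSpace X] (μ : Measure X) (S : Set (Set X))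
    (p : ℝ) (σ u : X → ℝ≥0∞) : ℝ≥0∞ :=
  ⨆ (f : X → ℝ≥0∞) (_ : Measurable f) (_ : strongNorm μ p σ f ≤ 1),
    strongNorm μ p u (sparseOp μ S (fun x => f x * σ x))

/-- The norm of `T^S(· σ)` from `L^p(σ)` to `L^{p,∞}(u)`. -/
noncomputable def weakOpNorm {X : Type*} [MeasurableSpace X] (μ : Measure X) (S : Set (Set X))
    (p : ℝ) (σ u : X → ℝ≥0∞) : ℝ≥0∞ :=
  ⨆ (f : X → ℝ≥0∞) (_ : Measurable f) (_ : strongNorm μ p σ f ≤ 1),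
    weakNorm μ p u (sparseOp μ S (fun x => f x * σ x))

/-! By duality the strong bound is a bound for the form `∑ μ(Q)⁻¹ (∫_Q f dσ)(∫_Q g du)` with `f`,
`g` in the unit balls of `L^p(σ)` and `L^{p'}(u)`, and finite subfamilies suffice. Kolmogorov's
inequality turns each weak bound into an estimate of this form when one of the two functions is an
indicator `1_A` (`IsCubeFamily.sum_le_of_weak`). The task is to replace a general function by
indicators without loss.

Split the cubes according to which of `⟨f⟩^p σ(Q)` and `⟨g⟩^{p'} u(Q)` is larger; by symmetry let
`f` dominate. Sort the cubes by the dyadic level `k` of the running maximum of `⟨f⟩` over larger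
cubes, and let `Ω_k` be the union of the cubes of level `k`. On such cubes `∫_Q f dσ ≤ 2^{k+1} σ(Q ∩
Ω_k)`, so `f` becomes a multiple of `1_{Ω_k}`. In turn `g` may be replaced by `g 1_{E_k} + h_k`,
where `E_k` is `Ω_k` without the cubes of higher level and `h_k` averages `g` over the maximal cubes
of higher level inside level-`k` cubes (`setLIntegral_le_add_averageOn`).

Hölder in `k` then closes the sum. The maximal theorem bounds `∑ 2^{kp} σ(Ω_k)`, the sets `E_k` are
disjoint, and `∑ ‖h_k‖^{p'}` is a sum of `⟨g⟩^{p'} u(P)` over distinct cubes, which domination by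
`f` again reduces to `∑ 2^{kp} σ(Ω_k)` (`sum_mul_setLIntegral_le_of_dominated`).

Sparseness serves only to make the family countable. The reverse inequality is Chebyshev together
with self-adjointness of `T^S`. -/

section

/-! ### Geometric sums, Kolmogorov's inequality and the converse of Hölder's inequality. -/

/-- The sum of the geometric series with ratio `2 ^ (-q)`. -/
noncomputable def geomConst (q : ℝ) : ℝ≥0∞ := (1 - 2 ^ (-q))⁻¹

lemma geomConst_ne_top {q : ℝ} (hq : 0 < q) : geomConst q ≠ ∞ := by
  have h : (2 : ℝ≥0∞) ^ (-q) < 1 :=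
    ENNReal.rpow_lt_one_of_one_lt_of_neg (by norm_num) (by linarith)
  exact ENNReal.inv_ne_top.2 (tsub_pos_of_lt h).ne'

lemma tsum_two_rpow_neg_mul (q : ℝ) :
    ∑' j : ℕ, (2 : ℝ≥0∞) ^ (-((j : ℝ) * q)) = geomConst q := by
  rw [geomConst, ← ENNReal.tsum_geometric]
  refine tsum_congr fun j => ?_
  rw [← ENNReal.rpow_natCast, ← ENNReal.rpow_mul]
  ring_nf

lemma two_rpow_add (a b : ℝ) : (2 : ℝ≥0∞) ^ (a + b) = 2 ^ a * 2 ^ b :=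
  ENNReal.rpow_add _ _ (by norm_num) (by norm_num)

/-- A geometric sum is comparable to its top term: reindexing by the distance `K - k` embeds it in
the full series. -/
lemma sum_two_rpow_le {I : Finset ℤ} {K : ℤ} (hI : ∀ k ∈ I, k ≤ K) (q : ℝ) :
    ∑ k ∈ I, (2 : ℝ≥0∞) ^ ((k : ℝ) * q) ≤ geomConst q * 2 ^ ((K : ℝ) * q) := by
  classical
  have hinj : Set.InjOn (fun k : ℤ => (K - k).toNat) I := by
    intro a ha b hb hab
    have := hI a ha
    have := hI b hb
    simp only at hab
    omega
  calc ∑ k ∈ I, (2 : ℝ≥0∞) ^ ((k : ℝ) * q)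
      = ∑ k ∈ I, (2 : ℝ≥0∞) ^ (-(((K - k).toNat : ℝ) * q)) * 2 ^ ((K : ℝ) * q) := by
        refine Finset.sum_congr rfl fun k hk => ?_
        rw [← two_rpow_add]
        have h : (((K - k).toNat : ℤ) : ℝ) = ((K - k : ℤ) : ℝ) := by
          rw [Int.toNat_of_nonneg (by linarith [hI k hk])]
        have h' : (((K - k).toNat : ℕ) : ℝ) = (K : ℝ) - k := by exact_mod_cast h
        rw [h']
        ring_nf
    _ = (∑ j ∈ I.image (fun k : ℤ => (K - k).toNat), (2 : ℝ≥0∞) ^ (-((j : ℝ) * q)))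
          * 2 ^ ((K : ℝ) * q) := by
        rw [Finset.sum_image hinj, Finset.sum_mul]
    _ ≤ _ := by
        gcongr
        rw [← tsum_two_rpow_neg_mul]
        exact ENNReal.sum_le_tsum _

/-- If `a` is finite and above `τ`, the single term with `2 ^ j * τ < a ≤ 2 ^ (j + 1) * τ` already
suffices; if `a` exceeds every `2 ^ j * τ`, all terms are at least `τ ≠ 0` and the series diverges.
-/
lemma le_add_tsum_dyadic_levels {τ : ℝ≥0∞} (hτ : τ ≠ 0) (a : ℝ≥0∞) :
    a ≤ τ + ∑' j : ℕ, if 2 ^ j * τ < a then 2 ^ (j + 1) * τ else 0 := by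
  classical
  by_cases h : ∃ j : ℕ, a ≤ 2 ^ j * τ
  · have hs := Nat.find_spec h
    rcases hj : Nat.find h with _ | i
    · rw [hj] at hs
      exact le_add_right (by simpa using hs)
    · rw [hj] at hs
      have hlt : 2 ^ i * τ < a := not_le.1 (Nat.find_min h (by omega))
      refine hs.trans (le_add_left ?_)
      refine le_trans ?_ (ENNReal.le_tsum i)
      rw [if_pos hlt]
  · push Not at h
    have : ∑' j : ℕ, (if 2 ^ j * τ < a then 2 ^ (j + 1) * τ else 0) = ∞ := by
      rw [eq_top_iff, ← ENNReal.tsum_const_eq_top_of_ne_zero (α := ℕ) hτ]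
      refine ENNReal.tsum_le_tsum fun j => ?_
      rw [if_pos (h j)]
      exact le_mul_of_one_le_left' (one_le_pow₀ (by norm_num))
    rw [this]
    simp

variable {X : Type*} [MeasurableSpace X]

lemma setLIntegral_le_dyadic_levels (ν : Measure X) {H : X → ℝ≥0∞} (hH : Measurable H) (A : Set X)
    {τ : ℝ≥0∞} (hτ : τ ≠ 0) :
    ∫⁻ x in A, H x ∂ν ≤
      τ * ν A + ∑' j : ℕ, 2 ^ (j + 1) * τ * ν {x | 2 ^ j * τ < H x} := by
  have hm : ∀ j : ℕ, MeasurableSet {x | 2 ^ j * τ < H x} := fun j =>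
    measurableSet_lt measurable_const hH
  calc ∫⁻ x in A, H x ∂ν
      ≤ ∫⁻ x in A, (τ + ∑' j : ℕ,
          {x | 2 ^ j * τ < H x}.indicator (fun _ => 2 ^ (j + 1) * τ) x) ∂ν := by
        refine lintegral_mono fun x => ?_
        simpa [Set.indicator_apply] using le_add_tsum_dyadic_levels hτ (H x)
    _ = τ * ν A + ∑' j : ℕ, 2 ^ (j + 1) * τ * (ν.restrict A) {x | 2 ^ j * τ < H x} := by
        rw [lintegral_add_left measurable_const, lintegral_tsum]
        · simp [lintegral_indicator (hm _), hm]
        · exact fun j => (measurable_const.indicator (hm j)).aemeasurable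
    _ ≤ _ := by
        gcongr
        exact Measure.restrict_le_self

/-- Kolmogorov's inequality: the integral over a set of finite measure of a function in weak `L^q`. -/
lemma setLIntegral_le_of_weak (ν : Measure X) {H : X → ℝ≥0∞} (hH : Measurable H) {A : Set X}
    (hA : ν A ≠ ∞) {p q : ℝ} (hpq : p.HolderConjugate q) {w : ℝ≥0∞}
    (hw : ∀ t : ℝ≥0, (t : ℝ≥0∞) * ν {x | (t : ℝ≥0∞) < H x} ^ (1 / q) ≤ w) :
    ∫⁻ x in A, H x ∂ν ≤ (1 + 2 * geomConst (q - 1)) * (w * ν A ^ (1 / p)) := by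
  have hq := hpq.symm.pos
  have hp := hpq.pos
  rcases eq_or_ne (ν A) 0 with hA0 | hA0
  · rw [Measure.restrict_eq_zero.2 hA0]
    simp
  rcases eq_or_ne w ∞ with rfl | hwt
  · have : ν A ^ (1 / p) ≠ 0 := by
      simp [ENNReal.rpow_eq_zero_iff, hA0, hA]
    rw [ENNReal.top_mul this, ENNReal.mul_top (by simp)]
    exact le_top
  rcases eq_or_ne w 0 with rfl | hw0
  -- The natural threshold `w / ν(A)^{1/q}` degenerates to `0` here, so the bound is taken at every
  -- positive threshold, which then tends to `0`.
  · have h0 : ∀ t : ℝ≥0, 0 < t → ν {x | (t : ℝ≥0∞) < H x} = 0 := by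
      intro t ht
      have := hw t
      simp only [nonpos_iff_eq_zero, mul_eq_zero, ENNReal.coe_eq_zero, ht.ne', false_or,
        ENNReal.rpow_eq_zero_iff] at this
      rcases this with h | h
      · exact h.1
      · have : 0 < 1 / q := by positivity
        linarith [h.2]
    have hle : ∀ τ : ℝ≥0, 0 < τ → ∫⁻ x in A, H x ∂ν ≤ τ * ν A := by
      intro τ hτ
      refine (setLIntegral_le_dyadic_levels ν hH A (ENNReal.coe_ne_zero.2 hτ.ne')).trans ?_
      have : ∀ j : ℕ, ν {x | 2 ^ j * (τ : ℝ≥0∞) < H x} = 0 := fun j => by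
        have := h0 (2 ^ j * τ) (by positivity)
        push_cast at this
        exact this
      simp [this]
    have : ∫⁻ x in A, H x ∂ν ≤ 0 := by
      refine ENNReal.le_of_forall_pos_le_add fun ε hε _ => ?_
      lift ν A to ℝ≥0 using hA with a ha
      have ha0 : a ≠ 0 := by simpa using hA0
      refine (hle (ε / a) (by positivity)).trans ?_
      rw [zero_add, ← ENNReal.coe_mul, div_mul_cancel₀ _ ha0]
    exact this.trans zero_le
  set a := ν A ^ (1 / q) with ha
  have ha0 : a ≠ 0 := by simp [ha, ENNReal.rpow_eq_zero_iff, hA0, hA]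
  have hat : a ≠ ∞ := by simp [ha, ENNReal.rpow_eq_top_iff, hA0, hA]
  have haq : a ^ q = ν A := by
    rw [ha, ← ENNReal.rpow_mul, one_div_mul_cancel hq.ne', ENNReal.rpow_one]
  -- At this height the weak bound for the level set equals `ν A`; below it the trivial bound by `ν
  -- A` is used, above it the weak bound decays like `2 ^ (-j q)`.
  set τ := w / a with hτ
  have hτ0 : τ ≠ 0 := by simp [hτ, ENNReal.div_eq_zero_iff, hw0, hat]
  have hτt : τ ≠ ∞ := by simp [hτ, ENNReal.div_eq_top, hwt, ha0]
  have hτa : τ * a = w := ENNReal.div_mul_cancel ha0 hat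
  have hτA : τ * ν A = w * ν A ^ (1 / p) := by
    have : ν A = a * ν A ^ (1 / p) := by
      rw [ha, ← ENNReal.rpow_add _ _ hA0 hA]
      have : 1 / q + 1 / p = 1 := by simpa using hpq.symm.inv_add_inv_eq_one
      rw [this, ENNReal.rpow_one]
    rw [this, ← mul_assoc, hτa, ← this]
  have hlev : ∀ j : ℕ, ν {x | 2 ^ j * τ < H x} ≤ 2 ^ (-((j : ℝ) * q)) * ν A := by
    intro j
    have h2 : (2 : ℝ≥0∞) ^ j ≠ 0 := by simp
    have h2t : (2 : ℝ≥0∞) ^ j ≠ ∞ := by simp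
    have h2τ : (2 : ℝ≥0∞) ^ j * τ ≠ ∞ := ENNReal.mul_ne_top h2t hτt
    have := hw ((2 ^ j * τ).toNNReal)
    rw [ENNReal.coe_toNNReal h2τ, ← hτa, mul_comm ((2 : ℝ≥0∞) ^ j) τ, mul_assoc,
      ENNReal.mul_le_mul_iff_right hτ0 hτt, mul_comm τ] at this
    have h3 := ENNReal.rpow_le_rpow this hq.le
    rw [ENNReal.mul_rpow_of_nonneg _ _ hq.le, ← ENNReal.rpow_mul, one_div_mul_cancel hq.ne',
      ENNReal.rpow_one, haq] at h3
    rw [← ENNReal.rpow_natCast, ← ENNReal.rpow_mul] at h3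
    rw [ENNReal.rpow_neg, ← ENNReal.div_eq_inv_mul, ENNReal.le_div_iff_mul_le (by simp) (by simp),
      ← ENNReal.rpow_natCast, mul_comm (ν _)]
    exact h3
  calc ∫⁻ x in A, H x ∂ν
      ≤ τ * ν A + ∑' j : ℕ, 2 ^ (j + 1) * τ * ν {x | 2 ^ j * τ < H x} :=
        setLIntegral_le_dyadic_levels ν hH A hτ0
    _ ≤ τ * ν A + ∑' j : ℕ, 2 * 2 ^ (-((j : ℝ) * (q - 1))) * (τ * ν A) := by
        refine add_le_add le_rfl (ENNReal.tsum_le_tsum fun j => ?_)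
        calc 2 ^ (j + 1) * τ * ν {x | 2 ^ j * τ < H x}
            ≤ 2 ^ (j + 1) * τ * (2 ^ (-((j : ℝ) * q)) * ν A) := by gcongr; exact hlev j
          _ = 2 * (2 ^ (j : ℝ) * 2 ^ (-((j : ℝ) * q))) * (τ * ν A) := by
              rw [pow_succ, ← ENNReal.rpow_natCast]; ring
          _ = _ := by rw [← two_rpow_add]; ring_nf
    _ = _ := by
        rw [ENNReal.tsum_mul_right, ENNReal.tsum_mul_left, tsum_two_rpow_neg_mul, hτA]
        ring

/-- The converse of Hölder's inequality. -/
lemma lintegral_rpow_le_of_forall_lintegral_mul_le (ν : Measure X) [SigmaFinite ν] {p q : ℝ}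
    (hpq : p.HolderConjugate q) {h : X → ℝ≥0∞} (hh : Measurable h) {B : ℝ≥0∞}
    (hB : ∀ f : X → ℝ≥0∞, Measurable f → ∫⁻ x, f x ^ p ∂ν ≤ 1 → ∫⁻ x, h x * f x ∂ν ≤ B) :
    (∫⁻ x, h x ^ q ∂ν) ^ (1 / q) ≤ B := by
  have hq := hpq.symm.pos
  have hp := hpq.pos
  -- Truncation in space and height makes `∫ H n ^ q` finite, so that it can be divided out;
  -- monotone convergence removes it at the end.
  set H : ℕ → X → ℝ≥0∞ := fun n => (spanningSets ν n).indicator fun x => min (h x) n with hHdef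
  have hHm : ∀ n, Measurable (H n) := fun n =>
    (hh.min measurable_const).indicator (measurableSet_spanningSets ν n)
  have hHle : ∀ n x, H n x ≤ h x := fun n x =>
    Set.indicator_apply_le' (fun _ => min_le_left _ _) (fun _ => zero_le)
  have hmono : Monotone H := by
    intro m n hmn x
    by_cases hx : x ∈ spanningSets ν m
    · have hx' : x ∈ spanningSets ν n := monotone_spanningSets ν hmn hx
      simp only [hHdef, Set.indicator_of_mem hx, Set.indicator_of_mem hx']
      gcongr
    · simp [hHdef, Set.indicator_of_notMem hx]
  have hsup : ∀ x, ⨆ n, H n x = h x := by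
    intro x
    refine le_antisymm (iSup_le fun n => hHle n x) ?_
    refine le_of_forall_lt fun c hc => ?_
    obtain ⟨m, hm⟩ := ENNReal.exists_nat_gt (ne_top_of_lt hc)
    set n := max m (spanningSetsIndex ν x)
    refine lt_of_lt_of_le ?_ (le_iSup _ n)
    have hx : x ∈ spanningSets ν n :=
      monotone_spanningSets ν (le_max_right _ _) (mem_spanningSetsIndex ν x)
    simp only [hHdef, Set.indicator_of_mem hx]
    exact lt_min hc (hm.trans_le (by exact_mod_cast le_max_left _ _))
  have hJ : ∀ n, ∫⁻ x, H n x ^ q ∂ν ≤ B ^ q := by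
    intro n
    set J := ∫⁻ x, H n x ^ q ∂ν with hJdef
    have hJt : J ≠ ∞ := by
      have hle : J ≤ ∫⁻ x, (spanningSets ν n).indicator (fun _ => (n : ℝ≥0∞) ^ q) x ∂ν := by
        refine lintegral_mono fun x => ?_
        by_cases hx : x ∈ spanningSets ν n
        · simp only [hHdef, Set.indicator_of_mem hx]
          gcongr
          exact min_le_right _ _
        · simp [hHdef, Set.indicator_of_notMem hx, ENNReal.zero_rpow_of_pos hq]
      refine ne_top_of_le_ne_top ?_ hle
      rw [lintegral_indicator (measurableSet_spanningSets ν n), setLIntegral_const]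
      exact ENNReal.mul_ne_top (ENNReal.rpow_ne_top_of_nonneg hq.le (ENNReal.natCast_ne_top n))
        (measure_spanningSets_lt_top ν n).ne
    rcases eq_or_ne J 0 with hJ0 | hJ0
    · rw [hJ0]; exact zero_le
    -- The extremal function of Hölder's inequality, normalised in `L^p` because `(q - 1) p = q`.
    have hfm : Measurable fun x => H n x ^ (q - 1) * J ^ (-(1 / p)) :=
      ((hHm n).pow_const _).mul_const _
    have hqp : (q - 1) * p = q := hpq.symm.sub_one_mul_conj
    have hone := hB _ hfm (by
      calc ∫⁻ x, (H n x ^ (q - 1) * J ^ (-(1 / p))) ^ p ∂ν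
          = ∫⁻ x, H n x ^ q * J⁻¹ ∂ν := by
            refine lintegral_congr fun x => ?_
            rw [ENNReal.mul_rpow_of_nonneg _ _ hp.le, ← ENNReal.rpow_mul, ← ENNReal.rpow_mul, hqp,
              neg_mul, one_div_mul_cancel hp.ne', ENNReal.rpow_neg_one]
        _ = J * J⁻¹ := by rw [lintegral_mul_const _ ((hHm n).pow_const _)]
        _ ≤ 1 := ENNReal.mul_inv_le_one J)
    have hle : J * J ^ (-(1 / p)) ≤ B := by
      refine le_trans ?_ hone
      rw [hJdef, ← lintegral_mul_const _ ((hHm n).pow_const _)]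
      refine lintegral_mono fun x => ?_
      rw [← mul_assoc]
      gcongr
      calc H n x ^ q = H n x ^ (1 + (q - 1)) := by ring_nf
        _ = H n x * H n x ^ (q - 1) := by
            rw [ENNReal.rpow_add_of_nonneg _ _ zero_le_one (by linarith [hpq.symm.lt]),
              ENNReal.rpow_one]
        _ ≤ h x * H n x ^ (q - 1) := by gcongr; exact hHle n x
    have hJq : J * J ^ (-(1 / p)) = J ^ (1 / q) := by
      nth_rw 1 [← ENNReal.rpow_one J]
      rw [← ENNReal.rpow_add _ _ hJ0 hJt]
      congr 1
      have : 1 / q + 1 / p = 1 := by simpa using hpq.symm.inv_add_inv_eq_one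
      linarith
    rw [hJq] at hle
    have := ENNReal.rpow_le_rpow hle hq.le
    rwa [← ENNReal.rpow_mul, one_div_mul_cancel hq.ne', ENNReal.rpow_one] at this
  have hlim : ∫⁻ x, h x ^ q ∂ν ≤ B ^ q := by
    have : ∀ x, h x ^ q = ⨆ n, H n x ^ q := by
      intro x
      rw [← hsup x]
      exact (ENNReal.orderIsoRpow q hq).map_iSup _
    simp_rw [this]
    rw [lintegral_iSup (fun n => (hHm n).pow_const _)
      (fun m n hmn x => ENNReal.rpow_le_rpow (hmono hmn x) hq.le)]
    exact iSup_le hJ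
  calc (∫⁻ x, h x ^ q ∂ν) ^ (1 / q) ≤ (B ^ q) ^ (1 / q) := by gcongr
    _ = B := by rw [← ENNReal.rpow_mul, mul_one_div_cancel hq.ne', ENNReal.rpow_one]

end

/-! ### Laminar families, dyadic levels and stopping cubes. -/

section

variable {X : Type*}

/-- Any two members of the family are disjoint or nested. -/
def IsLaminar (S : Finset (Set X)) : Prop :=
  ∀ Q ∈ S, ∀ R ∈ S, Disjoint Q R ∨ Q ⊆ R ∨ R ⊆ Q

lemma IsLaminar.mono {S T : Finset (Set X)} (hS : IsLaminar S) (h : T ⊆ S) : IsLaminar T :=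
  fun Q hQ R hR => hS Q (h hQ) R (h hR)

open Classical in
/-- The inclusion-maximal members of a finite family of sets. -/
noncomputable def maximalCubes (T : Finset (Set X)) : Finset (Set X) :=
  T.filter fun Q => ∀ R ∈ T, Q ⊆ R → R = Q

lemma mem_maximalCubes {T : Finset (Set X)} {Q : Set X} :
    Q ∈ maximalCubes T ↔ Q ∈ T ∧ ∀ R ∈ T, Q ⊆ R → R = Q := by
  simp [maximalCubes]

lemma exists_mem_maximalCubes {T : Finset (Set X)} {Q : Set X} (hQ : Q ∈ T) :
    ∃ R ∈ maximalCubes T, Q ⊆ R := by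
  obtain ⟨R, hQR, hR⟩ := T.exists_le_maximal hQ
  exact ⟨R, mem_maximalCubes.2 ⟨hR.1, fun R' hR' h => (hR.2 hR' h).antisymm h⟩, hQR⟩

lemma IsLaminar.pairwiseDisjoint_maximalCubes {T : Finset (Set X)} (hT : IsLaminar T) :
    (maximalCubes T : Set (Set X)).PairwiseDisjoint id := by
  intro Q hQ R hR hne
  have hQ := mem_maximalCubes.1 hQ
  have hR := mem_maximalCubes.1 hR
  rcases hT Q hQ.1 R hR.1 with h | h | h
  · exact h
  · exact absurd (hQ.2 R hR.1 h).symm hne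
  · exact absurd (hR.2 Q hQ.1 h) hne

/-- `ℓ` is the dyadic level of the running maximum of `a` along the family `S`. -/
structure IsLevel (S : Finset (Set X)) (a : Set X → ℝ≥0∞) (ℓ : Set X → ℤ) : Prop where
  le_two_rpow : ∀ Q ∈ S, a Q ≤ 2 ^ ((ℓ Q : ℝ) + 1)
  exists_superset : ∀ Q ∈ S, ∃ R ∈ S, Q ⊆ R ∧ ℓ R = ℓ Q ∧ 2 ^ (ℓ Q : ℝ) ≤ a R
  anti : ∀ Q ∈ S, ∀ R ∈ S, Q ⊆ R → ℓ R ≤ ℓ Q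

/-- Take `2 ^ ℓ Q < M Q ≤ 2 ^ (ℓ Q + 1)`, where `M Q` is the maximum of `a` over the members
containing `Q`. A member attaining the maximum has the same `M`, hence the same level. Positivity
and finiteness of `a` make the level an integer. -/
lemma exists_isLevel (S : Finset (Set X)) (a : Set X → ℝ≥0∞) (h0 : ∀ Q ∈ S, a Q ≠ 0)
    (ht : ∀ Q ∈ S, a Q ≠ ∞) : ∃ ℓ, IsLevel S a ℓ := by
  classical
  set M : Set X → ℝ≥0∞ := fun Q => (S.filter (Q ⊆ ·)).sup a with hM
  have hle : ∀ Q, ∀ R ∈ S, Q ⊆ R → a R ≤ M Q := fun Q R hR h =>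
    Finset.le_sup (f := a) (Finset.mem_filter.2 ⟨hR, h⟩)
  have hex : ∀ Q ∈ S, ∃ R ∈ S, Q ⊆ R ∧ M Q = a R := by
    intro Q hQ
    obtain ⟨R, hR, h⟩ := Finset.exists_mem_eq_sup (S.filter (Q ⊆ ·))
      ⟨Q, Finset.mem_filter.2 ⟨hQ, subset_rfl⟩⟩ a
    exact ⟨R, (Finset.mem_filter.1 hR).1, (Finset.mem_filter.1 hR).2, h⟩
  have hanti : ∀ Q ∈ S, ∀ R ∈ S, Q ⊆ R → M R ≤ M Q := by
    intro Q _ R hR h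
    obtain ⟨R', hR', h', e⟩ := hex R hR
    rw [e]
    exact hle Q R' hR' (h.trans h')
  have hlev : ∀ Q : Set X, ∃ k : ℤ, Q ∈ S → (2 : ℝ≥0∞) ^ (k : ℝ) < M Q ∧
      M Q ≤ 2 ^ ((k : ℝ) + 1) := by
    intro Q
    by_cases hQ : Q ∈ S
    · obtain ⟨R, hR, _, e⟩ := hex Q hQ
      obtain ⟨k, hk⟩ := ENNReal.exists_mem_Ioc_zpow (x := M Q) (y := 2) (by rw [e]; exact h0 R hR)
        (by rw [e]; exact ht R hR) (by norm_num) (by norm_num)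
      refine ⟨k, fun _ => ?_⟩
      have h1 := hk.1
      have h2 := hk.2
      rw [← ENNReal.rpow_intCast] at h1 h2
      push_cast at h2
      exact ⟨h1, h2⟩
    · exact ⟨0, fun h => absurd h hQ⟩
  choose ℓ hℓ using hlev
  have hanti' : ∀ Q ∈ S, ∀ R ∈ S, M R ≤ M Q → ℓ R ≤ ℓ Q := by
    intro Q hQ R hR h
    have : (2 : ℝ≥0∞) ^ (ℓ R : ℝ) < 2 ^ ((ℓ Q : ℝ) + 1) :=
      ((hℓ R hR).1.trans_le h).trans_le (hℓ Q hQ).2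
    have h' : (ℓ R : ℝ) < (ℓ Q : ℝ) + 1 := lt_of_not_ge fun hge =>
      this.not_ge (ENNReal.rpow_le_rpow_of_exponent_le (by norm_num) hge)
    have : ℓ R < ℓ Q + 1 := by exact_mod_cast h'
    omega
  refine ⟨ℓ, fun Q hQ => (hle Q Q hQ subset_rfl).trans (hℓ Q hQ).2, fun Q hQ => ?_,
    fun Q hQ R hR h => hanti' Q hQ R hR (hanti Q hQ R hR h)⟩
  obtain ⟨R, hR, hQR, e⟩ := hex Q hQ
  have hMR : M R = M Q := le_antisymm (hanti Q hQ R hR hQR) (e ▸ hle R R hR subset_rfl)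
  exact ⟨R, hR, hQR, le_antisymm (hanti' Q hQ R hR hMR.le) (hanti' R hR Q hQ hMR.ge),
    e ▸ (hℓ Q hQ).1.le⟩

/-- The union of the members of `S` of level `k`. -/
def levelUnion (S : Finset (Set X)) (ℓ : Set X → ℤ) (k : ℤ) : Set X :=
  ⋃ Q ∈ S.filter (ℓ · = k), Q

lemma mem_levelUnion {S : Finset (Set X)} {ℓ : Set X → ℤ} {k : ℤ} {x : X} :
    x ∈ levelUnion S ℓ k ↔ ∃ Q ∈ S, ℓ Q = k ∧ x ∈ Q := by
  simp [levelUnion, and_assoc]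

/-- The union of the members of `S` of level greater than `k`. -/
def upperUnion (S : Finset (Set X)) (ℓ : Set X → ℤ) (k : ℤ) : Set X :=
  ⋃ Q ∈ S.filter (k < ℓ ·), Q

lemma mem_upperUnion {S : Finset (Set X)} {ℓ : Set X → ℤ} {k : ℤ} {x : X} :
    x ∈ upperUnion S ℓ k ↔ ∃ Q ∈ S, k < ℓ Q ∧ x ∈ Q := by
  simp [upperUnion, and_assoc]

open Classical in
/-- The maximal members of `S` of level greater than `k` that are contained in a member of
level `k`. -/
noncomputable def stoppingCubes (S : Finset (Set X)) (ℓ : Set X → ℤ) (k : ℤ) : Finset (Set X) :=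
  (maximalCubes (S.filter (k < ℓ ·))).filter fun P => ∃ Q ∈ S, ℓ Q = k ∧ P ⊆ Q

lemma mem_stoppingCubes {S : Finset (Set X)} {ℓ : Set X → ℤ} {k : ℤ} {P : Set X} :
    P ∈ stoppingCubes S ℓ k ↔
      P ∈ maximalCubes (S.filter (k < ℓ ·)) ∧ ∃ Q ∈ S, ℓ Q = k ∧ P ⊆ Q := by
  simp [stoppingCubes]

lemma IsLaminar.pairwiseDisjoint_stoppingCubes {S : Finset (Set X)} (hS : IsLaminar S)
    (ℓ : Set X → ℤ) (k : ℤ) : (stoppingCubes S ℓ k : Set (Set X)).PairwiseDisjoint id :=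
  (hS.mono (Finset.filter_subset _ _)).pairwiseDisjoint_maximalCubes.subset
    fun _ hP => (mem_stoppingCubes.1 hP).1

/-- For `k < k'`, a common cube lies in a cube of level `k'`, which competes in the maximality
condition for `k`. The two must coincide, yet the stopping cube has level above `k'`. -/
lemma disjoint_stoppingCubes (S : Finset (Set X)) (ℓ : Set X → ℤ) {k k' : ℤ} (hne : k ≠ k') :
    Disjoint (stoppingCubes S ℓ k) (stoppingCubes S ℓ k') := by
  wlog h : k < k' generalizing k k'
  · exact (this hne.symm (lt_of_le_of_ne (not_lt.1 h) hne.symm)).symm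
  rw [Finset.disjoint_left]
  intro P hP hP'
  obtain ⟨hP, -⟩ := mem_stoppingCubes.1 hP
  obtain ⟨hP', Q, hQ, rfl, hPQ⟩ := mem_stoppingCubes.1 hP'
  have := (mem_maximalCubes.1 hP).2 Q (Finset.mem_filter.2 ⟨hQ, h⟩) hPQ
  have h2 := (Finset.mem_filter.1 (mem_maximalCubes.1 hP').1).2
  rw [this] at h2
  exact lt_irrefl _ h2

/-- A larger cube of level `ℓ P` would also have level above `k`, against the maximality of `P`. -/
lemma mem_maximalCubes_of_mem_stoppingCubes {S : Finset (Set X)} {ℓ : Set X → ℤ} {k : ℤ}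
    {P : Set X} (hP : P ∈ stoppingCubes S ℓ k) :
    P ∈ maximalCubes (S.filter (ℓ · = ℓ P)) := by
  obtain ⟨hP, -⟩ := mem_stoppingCubes.1 hP
  obtain ⟨hP, hmax⟩ := mem_maximalCubes.1 hP
  obtain ⟨hPS, hk⟩ := Finset.mem_filter.1 hP
  refine mem_maximalCubes.2 ⟨by simp [hPS], fun R hR hPR => hmax R ?_ hPR⟩
  obtain ⟨hRS, hR⟩ := Finset.mem_filter.1 hR
  exact Finset.mem_filter.2 ⟨hRS, by omega⟩

/-! ### The maximal theorem for the level sets. -/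

variable [MeasurableSpace X]

lemma measurableSet_levelUnion {S : Finset (Set X)} (hm : ∀ Q ∈ S, MeasurableSet Q)
    (ℓ : Set X → ℤ) (k : ℤ) : MeasurableSet (levelUnion S ℓ k) :=
  Finset.measurableSet_biUnion _ fun Q hQ => hm Q (Finset.mem_filter.1 hQ).1

lemma measurableSet_upperUnion {S : Finset (Set X)} (hm : ∀ Q ∈ S, MeasurableSet Q)
    (ℓ : Set X → ℤ) (k : ℤ) : MeasurableSet (upperUnion S ℓ k) :=
  Finset.measurableSet_biUnion _ fun Q hQ => hm Q (Finset.mem_filter.1 hQ).1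

lemma sum_measure_maximalCubes_le {S : Finset (Set X)} (hS : IsLaminar S)
    (hm : ∀ Q ∈ S, MeasurableSet Q) (ℓ : Set X → ℤ) (k : ℤ) (s : Measure X) :
    ∑ G ∈ maximalCubes (S.filter (ℓ · = k)), s G ≤ s (levelUnion S ℓ k) := by
  have hsub : ∀ G ∈ maximalCubes (S.filter (ℓ · = k)), G ∈ S.filter (ℓ · = k) :=
    fun G hG => (mem_maximalCubes.1 hG).1
  have := measure_biUnion_finset (μ := s)
    (hS.mono (Finset.filter_subset (ℓ · = k) _)).pairwiseDisjoint_maximalCubes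
    (fun G hG => hm G (Finset.mem_filter.1 (hsub G hG)).1)
  simp only [id] at this
  rw [← this]
  exact measure_mono (Set.biUnion_subset_biUnion_left hsub)

/-- On a maximal cube of level `k` the running maximum is attained by the cube itself: the superset
supplied by `exists_superset` has the same level. So its own average is at least `2 ^ k`, and these
disjoint cubes cover the level set. -/
lemma two_rpow_mul_measure_levelUnion_le {S : Finset (Set X)} (hS : IsLaminar S)
    (hm : ∀ Q ∈ S, MeasurableSet Q) {s : Measure X} (hs : ∀ Q ∈ S, s Q ≠ ∞) {f : X → ℝ≥0∞}
    {ℓ : Set X → ℤ} (hℓ : IsLevel S (fun Q => ⨍⁻ x in Q, f x ∂s) ℓ) (k : ℤ) :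
    2 ^ (k : ℝ) * s (levelUnion S ℓ k) ≤ ∫⁻ x in levelUnion S ℓ k, f x ∂s := by
  set G := maximalCubes (S.filter (ℓ · = k)) with hG
  have hsub : ∀ Q ∈ G, Q ∈ S.filter (ℓ · = k) := fun Q hQ => (mem_maximalCubes.1 hQ).1
  have hGS : ∀ Q ∈ G, Q ∈ S := fun Q hQ => (Finset.mem_filter.1 (hsub Q hQ)).1
  have hcover : levelUnion S ℓ k = ⋃ Q ∈ G, Q := by
    refine subset_antisymm (Set.iUnion₂_subset fun Q hQ => ?_)
      (Set.biUnion_subset_biUnion_left hsub)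
    obtain ⟨R, hR, h⟩ := exists_mem_maximalCubes hQ
    exact h.trans (Set.subset_biUnion_of_mem (u := fun Q => Q) hR)
  have hdisj := (hS.mono (Finset.filter_subset (ℓ · = k) _)).pairwiseDisjoint_maximalCubes
  rw [hcover, lintegral_biUnion_finset (t := fun Q => Q) hdisj fun Q hQ => hm Q (hGS Q hQ)]
  calc 2 ^ (k : ℝ) * s (⋃ Q ∈ G, Q) ≤ 2 ^ (k : ℝ) * ∑ Q ∈ G, s Q := by
        gcongr
        exact measure_biUnion_finset_le _ _
    _ = ∑ Q ∈ G, 2 ^ (k : ℝ) * s Q := Finset.mul_sum _ _ _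
    _ ≤ _ := by
        refine Finset.sum_le_sum fun Q hQ => ?_
        obtain ⟨hQ', hmax⟩ := mem_maximalCubes.1 hQ
        obtain ⟨hQS, hQk⟩ := Finset.mem_filter.1 hQ'
        obtain ⟨R, hR, hQR, hlev, hle⟩ := hℓ.exists_superset Q hQS
        have hRQ : R = Q := hmax R (Finset.mem_filter.2 ⟨hR, hlev.trans hQk⟩) hQR
        rw [hQk, hRQ] at hle
        rw [← measure_mul_setLAverage f (hs Q hQS), mul_comm]
        gcongr

/-- At each point the left sum is geometric, so it is controlled by its largest term, whose `q`-th
power is a term on the right because `(p - 1) q = p`. -/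
lemma sum_indicator_two_rpow_le {ι : Type*} (I : Finset ℤ) (Ω : ℤ → Set ι) {p q : ℝ}
    (hpq : p.HolderConjugate q) (x : ι) :
    (∑ k ∈ I, (Ω k).indicator (fun _ => (2 : ℝ≥0∞) ^ ((k : ℝ) * (p - 1))) x) ^ q ≤
      geomConst (p - 1) ^ q * ∑ k ∈ I, (Ω k).indicator (fun _ => (2 : ℝ≥0∞) ^ ((k : ℝ) * p)) x := by
  classical
  have hq := hpq.symm.pos
  simp only [Set.indicator_apply, ← Finset.sum_filter]
  set J := I.filter (x ∈ Ω ·) with hJ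
  rcases J.eq_empty_or_nonempty with h | h
  · simp [h, ENNReal.zero_rpow_of_pos hq]
  · set K := J.max' h
    have hK : K ∈ J := J.max'_mem h
    have hpq' : (p - 1) * q = p := hpq.sub_one_mul_conj
    calc (∑ k ∈ J, (2 : ℝ≥0∞) ^ ((k : ℝ) * (p - 1))) ^ q
        ≤ (geomConst (p - 1) * 2 ^ ((K : ℝ) * (p - 1))) ^ q := by
          gcongr
          exact sum_two_rpow_le (fun k hk => J.le_max' k hk) _
      _ = geomConst (p - 1) ^ q * 2 ^ ((K : ℝ) * p) := by
          rw [ENNReal.mul_rpow_of_nonneg _ _ hq.le, ← ENNReal.rpow_mul, mul_assoc, hpq']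
      _ ≤ _ := by
          gcongr
          exact Finset.single_le_sum (f := fun k : ℤ => (2 : ℝ≥0∞) ^ ((k : ℝ) * p))
            (fun _ _ => zero_le) hK

/-- The maximal theorem, in the form of a bound for the level sets of the dyadic maximal
function. -/
lemma sum_two_rpow_mul_measure_levelUnion_le {S : Finset (Set X)} (hS : IsLaminar S)
    (hm : ∀ Q ∈ S, MeasurableSet Q) {s : Measure X} (hs : ∀ Q ∈ S, s Q ≠ ∞) {f : X → ℝ≥0∞}
    (hf : Measurable f) {p q : ℝ} (hpq : p.HolderConjugate q)
    {ℓ : Set X → ℤ} (hℓ : IsLevel S (fun Q => ⨍⁻ x in Q, f x ∂s) ℓ) (I : Finset ℤ) :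
    ∑ k ∈ I, 2 ^ ((k : ℝ) * p) * s (levelUnion S ℓ k) ≤
      geomConst (p - 1) ^ p * ∫⁻ x, f x ^ p ∂s := by
  have hp := hpq.pos
  have hq := hpq.symm.pos
  set Ω := levelUnion S ℓ with hΩ
  have hΩm : ∀ k, MeasurableSet (Ω k) := measurableSet_levelUnion hm ℓ
  set Z := ∑ k ∈ I, 2 ^ ((k : ℝ) * p) * s (Ω k) with hZ
  set c := geomConst (p - 1) with hc
  have hΩt : ∀ k, s (Ω k) ≠ ∞ := fun k => by
    refine ne_top_of_le_ne_top ?_ (measure_biUnion_finset_le _ _)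
    exact ENNReal.sum_ne_top.2 fun Q hQ => hs Q (Finset.mem_filter.1 hQ).1
  -- Finiteness of `Z` allows `Z ^ (1 / q)` to be cancelled below.
  have hZt : Z ≠ ∞ := ENNReal.sum_ne_top.2 fun k _ => ENNReal.mul_ne_top (by simp) (hΩt k)
  set Φ : X → ℝ≥0∞ := fun x => ∑ k ∈ I, (Ω k).indicator (fun _ => (2 : ℝ≥0∞) ^ ((k : ℝ) * (p - 1))) x
    with hΦ
  have hΦm : Measurable Φ :=
    Finset.measurable_sum _ fun k _ => measurable_const.indicator (hΩm k)
  -- Linearisation: `Z` is bounded by a pairing of `f` with `Φ`, while `∫ Φ ^ q` is in turn bounded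
  -- by `Z`. Hölder then gives a self-improving inequality.
  have h1 : Z ≤ ∫⁻ x, (f * Φ) x ∂s := by
    calc Z ≤ ∑ k ∈ I, 2 ^ ((k : ℝ) * (p - 1)) * ∫⁻ x in Ω k, f x ∂s := by
          refine Finset.sum_le_sum fun k _ => ?_
          refine le_trans (le_of_eq ?_) (mul_le_mul_right
            (two_rpow_mul_measure_levelUnion_le hS hm hs hℓ k) _)
          rw [← mul_assoc, ← two_rpow_add, hΩ]
          ring_nf
      _ = ∑ k ∈ I, ∫⁻ x, f x * (Ω k).indicator (fun _ => (2 : ℝ≥0∞) ^ ((k : ℝ) * (p - 1))) x ∂s := by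
          refine Finset.sum_congr rfl fun k _ => ?_
          rw [← lintegral_indicator (hΩm k), ← lintegral_const_mul _ (hf.indicator (hΩm k))]
          refine lintegral_congr fun x => ?_
          by_cases hx : x ∈ Ω k <;> simp [hx, mul_comm]
      _ = ∫⁻ x, (f * Φ) x ∂s := by
          rw [← lintegral_finsetSum]
          · simp [hΦ, Finset.mul_sum]
          · exact fun k _ => hf.mul (measurable_const.indicator (hΩm k))
  have h2 : ∫⁻ x, Φ x ^ q ∂s ≤ c ^ q * Z := by
    calc ∫⁻ x, Φ x ^ q ∂s
        ≤ ∫⁻ x, c ^ q * ∑ k ∈ I, (Ω k).indicator (fun _ => (2 : ℝ≥0∞) ^ ((k : ℝ) * p)) x ∂s :=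
          lintegral_mono fun x => sum_indicator_two_rpow_le I Ω hpq x
      _ = c ^ q * Z := by
          rw [lintegral_const_mul _
            (Finset.measurable_sum _ fun k _ => measurable_const.indicator (hΩm k)),
            lintegral_finsetSum _ fun k _ => measurable_const.indicator (hΩm k)]
          congr 1
          refine Finset.sum_congr rfl fun k _ => ?_
          rw [lintegral_indicator (hΩm k), setLIntegral_const]
  rcases eq_or_ne Z 0 with hZ0 | hZ0
  · rw [hZ0]; exact zero_le
  have h3 : Z ≤ c * (∫⁻ x, f x ^ p ∂s) ^ (1 / p) * Z ^ (1 / q) := by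
    calc Z ≤ (∫⁻ x, f x ^ p ∂s) ^ (1 / p) * (∫⁻ x, Φ x ^ q ∂s) ^ (1 / q) :=
          h1.trans (ENNReal.lintegral_mul_le_Lp_mul_Lq s hpq hf.aemeasurable hΦm.aemeasurable)
      _ ≤ (∫⁻ x, f x ^ p ∂s) ^ (1 / p) * (c ^ q * Z) ^ (1 / q) := by gcongr
      _ = _ := by
          rw [ENNReal.mul_rpow_of_nonneg _ _ (by positivity), ← ENNReal.rpow_mul,
            mul_one_div_cancel hq.ne', ENNReal.rpow_one]
          ring
  have hZq0 : Z ^ (1 / q) ≠ 0 := by simp [ENNReal.rpow_eq_zero_iff, hZ0, hZt]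
  have hZqt : Z ^ (1 / q) ≠ ∞ := by simp [ENNReal.rpow_eq_top_iff, hZ0, hZt]
  have hsplit : Z = Z ^ (1 / p) * Z ^ (1 / q) := by
    rw [← ENNReal.rpow_add _ _ hZ0 hZt]
    have : 1 / p + 1 / q = 1 := by simpa using hpq.inv_add_inv_eq_one
    rw [this, ENNReal.rpow_one]
  replace h3 := hsplit.symm.trans_le h3
  rw [ENNReal.mul_le_mul_iff_left hZq0 hZqt] at h3
  have h4 := ENNReal.rpow_le_rpow h3 hp.le
  rw [ENNReal.mul_rpow_of_nonneg _ _ hp.le, ← ENNReal.rpow_mul, ← ENNReal.rpow_mul,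
    one_div_mul_cancel hp.ne', ENNReal.rpow_one, ENNReal.rpow_one] at h4
  exact h4

/-- No cube stops for two values of `k`, and each stopping cube is maximal within its own level. The
sum therefore runs over maximal cubes of all levels, where `a P ≤ 2 ^ (ℓ P + 1)`; this is the source
of `2 ^ p`. -/
lemma sum_stoppingCubes_le {S : Finset (Set X)} (hS : IsLaminar S)
    (hm : ∀ Q ∈ S, MeasurableSet Q) (s : Measure X) {a : Set X → ℝ≥0∞} {p : ℝ} (hp : 0 < p)
    {ℓ : Set X → ℤ} (hℓ : IsLevel S a ℓ) :
    ∑ k ∈ S.image ℓ, ∑ P ∈ stoppingCubes S ℓ k, a P ^ p * s P ≤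
      2 ^ p * ∑ k ∈ S.image ℓ, 2 ^ ((k : ℝ) * p) * s (levelUnion S ℓ k) := by
  classical
  have hdisj : ∀ k ∈ S.image ℓ, ∀ k' ∈ S.image ℓ, k ≠ k' →
      Disjoint (maximalCubes (S.filter (ℓ · = k))) (maximalCubes (S.filter (ℓ · = k'))) := by
    intro k _ k' _ hne
    rw [Finset.disjoint_left]
    intro P hP hP'
    have h1 := (Finset.mem_filter.1 (mem_maximalCubes.1 hP).1).2
    have h2 := (Finset.mem_filter.1 (mem_maximalCubes.1 hP').1).2
    exact hne (h1.symm.trans h2)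
  calc ∑ k ∈ S.image ℓ, ∑ P ∈ stoppingCubes S ℓ k, a P ^ p * s P
      = ∑ P ∈ (S.image ℓ).biUnion (stoppingCubes S ℓ), a P ^ p * s P :=
        (Finset.sum_biUnion fun k _ k' _ hne => disjoint_stoppingCubes S ℓ hne).symm
    _ ≤ ∑ P ∈ (S.image ℓ).biUnion fun k => maximalCubes (S.filter (ℓ · = k)), a P ^ p * s P := by
        refine Finset.sum_le_sum_of_subset fun P hP => ?_
        obtain ⟨k, -, hP⟩ := Finset.mem_biUnion.1 hP
        have hPmax := mem_maximalCubes_of_mem_stoppingCubes hP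
        have hPS := (Finset.mem_filter.1 (mem_maximalCubes.1 hPmax).1).1
        exact Finset.mem_biUnion.2 ⟨ℓ P, Finset.mem_image_of_mem ℓ hPS, hPmax⟩
    _ = ∑ k ∈ S.image ℓ, ∑ P ∈ maximalCubes (S.filter (ℓ · = k)), a P ^ p * s P :=
        Finset.sum_biUnion hdisj
    _ ≤ ∑ k ∈ S.image ℓ, 2 ^ p * (2 ^ ((k : ℝ) * p) * s (levelUnion S ℓ k)) := by
        refine Finset.sum_le_sum fun k _ => ?_
        calc ∑ P ∈ maximalCubes (S.filter (ℓ · = k)), a P ^ p * s P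
            ≤ ∑ P ∈ maximalCubes (S.filter (ℓ · = k)), 2 ^ p * 2 ^ ((k : ℝ) * p) * s P := by
              refine Finset.sum_le_sum fun P hP => ?_
              obtain ⟨hPS, hPk⟩ := Finset.mem_filter.1 (mem_maximalCubes.1 hP).1
              gcongr
              have := ENNReal.rpow_le_rpow (hℓ.le_two_rpow P hPS) hp.le
              rw [hPk, ← ENNReal.rpow_mul] at this
              rw [← two_rpow_add]
              refine this.trans_eq ?_
              ring_nf
          _ = 2 ^ p * 2 ^ ((k : ℝ) * p) * ∑ P ∈ maximalCubes (S.filter (ℓ · = k)), s P := by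
              rw [Finset.mul_sum]
          _ ≤ 2 ^ p * 2 ^ ((k : ℝ) * p) * s (levelUnion S ℓ k) := by
              gcongr
              exact sum_measure_maximalCubes_le hS hm ℓ k s
          _ = _ := mul_assoc _ _ _
    _ = _ := by rw [Finset.mul_sum]

/-! ### Splitting the second function at a given level. -/

/-- The function equal to the average of `g` on each member of the disjoint family `F`. -/
noncomputable def averageOn (v : Measure X) (F : Finset (Set X)) (g : X → ℝ≥0∞) (x : X) : ℝ≥0∞ :=
  ∑ P ∈ F, P.indicator (fun _ => ⨍⁻ y in P, g y ∂v) x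

lemma measurable_averageOn (v : Measure X) {F : Finset (Set X)} (hm : ∀ P ∈ F, MeasurableSet P)
    (g : X → ℝ≥0∞) : Measurable (averageOn v F g) :=
  Finset.measurable_sum _ fun P hP => measurable_const.indicator (hm P hP)

lemma lintegral_averageOn_rpow (v : Measure X) {F : Finset (Set X)}
    (hm : ∀ P ∈ F, MeasurableSet P) (hF : (F : Set (Set X)).PairwiseDisjoint id)
    (g : X → ℝ≥0∞) {q : ℝ} (hq : 0 < q) :
    ∫⁻ x, averageOn v F g x ^ q ∂v = ∑ P ∈ F, (⨍⁻ y in P, g y ∂v) ^ q * v P := by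
  have hpt : ∀ x, averageOn v F g x ^ q =
      ∑ P ∈ F, P.indicator (fun _ => (⨍⁻ y in P, g y ∂v) ^ q) x := by
    intro x
    by_cases hx : ∃ P ∈ F, x ∈ P
    · obtain ⟨P, hP, hxP⟩ := hx
      have hout : ∀ R ∈ F, R ≠ P → x ∉ R := fun R hR hne hxR =>
        Set.disjoint_left.1 (hF hR hP hne) hxR hxP
      rw [averageOn, Finset.sum_eq_single_of_mem P hP, Finset.sum_eq_single_of_mem P hP]
      · simp [hxP]
      · exact fun R hR hne => Set.indicator_of_notMem (hout R hR hne) _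
      · exact fun R hR hne => Set.indicator_of_notMem (hout R hR hne) _
    · push Not at hx
      rw [averageOn, Finset.sum_eq_zero fun P hP => Set.indicator_of_notMem (hx P hP) _,
        Finset.sum_eq_zero fun P hP => Set.indicator_of_notMem (hx P hP) _,
        ENNReal.zero_rpow_of_pos hq]
  simp_rw [hpt]
  rw [lintegral_finsetSum _ fun P hP => measurable_const.indicator (hm P hP)]
  refine Finset.sum_congr rfl fun P hP => ?_
  rw [lintegral_indicator (hm P hP), setLIntegral_const]

/-- Off the cubes of higher level `g` is kept. The rest of `Q` is covered by stopping cubes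
contained in `Q`, and replacing `g` by its average on each of them preserves the integral over `Q`.
-/
lemma setLIntegral_le_add_averageOn {S : Finset (Set X)} (hS : IsLaminar S)
    (hm : ∀ Q ∈ S, MeasurableSet Q) {v : Measure X} (hv : ∀ Q ∈ S, v Q ≠ ∞) (g : X → ℝ≥0∞)
    {a : Set X → ℝ≥0∞} {ℓ : Set X → ℤ} (hℓ : IsLevel S a ℓ) {Q : Set X} (hQ : Q ∈ S) :
    ∫⁻ x in Q, g x ∂v ≤
      ∫⁻ x in Q, (levelUnion S ℓ (ℓ Q) \ upperUnion S ℓ (ℓ Q)).indicator g x ∂v +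
      ∫⁻ x in Q, averageOn v (stoppingCubes S ℓ (ℓ Q)) g x ∂v := by
  classical
  set k := ℓ Q with hk
  set U := upperUnion S ℓ k with hU
  have hUm : MeasurableSet U := measurableSet_upperUnion hm ℓ k
  have hEm : MeasurableSet (levelUnion S ℓ k \ U) := (measurableSet_levelUnion hm ℓ k).diff hUm
  have hFS : ∀ P ∈ stoppingCubes S ℓ k, P ∈ S := fun P hP =>
    (Finset.mem_filter.1 (mem_maximalCubes.1 (mem_stoppingCubes.1 hP).1).1).1
  rw [← lintegral_inter_add_sdiff g Q hUm, add_comm]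
  gcongr ?_ + ?_
  · rw [lintegral_indicator hEm, Measure.restrict_restrict hEm]
    refine lintegral_mono_set fun x hx => ⟨⟨mem_levelUnion.2 ⟨Q, hQ, rfl, hx.1⟩, hx.2⟩, hx.1⟩
  · set F := (stoppingCubes S ℓ k).filter (· ⊆ Q) with hF
    have hcover : Q ∩ U ⊆ ⋃ P ∈ F, P := by
      rintro x ⟨hxQ, hxU⟩
      obtain ⟨R, hR, hRk, hxR⟩ := mem_upperUnion.1 hxU
      obtain ⟨P, hP, hRP⟩ := exists_mem_maximalCubes (Finset.mem_filter.2 ⟨hR, hRk⟩ :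
        R ∈ S.filter (k < ℓ ·))
      obtain ⟨hPS, hPk⟩ := Finset.mem_filter.1 (mem_maximalCubes.1 hP).1
      have hPQ : P ⊆ Q := by
        rcases hS P hPS Q hQ with h | h | h
        · exact absurd hxQ (Set.disjoint_left.1 h (hRP hxR))
        · exact h
        -- Levels increase towards smaller cubes, so a cube containing `Q` cannot have level above
        -- `ℓ Q`.
        · have := hℓ.anti Q hQ P hPS h
          omega
      refine Set.mem_biUnion (x := P) ?_ (hRP hxR)
      exact Finset.mem_filter.2 ⟨mem_stoppingCubes.2 ⟨hP, Q, hQ, rfl, hPQ⟩, hPQ⟩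
    calc ∫⁻ x in Q ∩ U, g x ∂v ≤ ∫⁻ x in ⋃ P ∈ F, P, g x ∂v := lintegral_mono_set hcover
      _ ≤ ∑ P ∈ F, ∫⁻ x in P, g x ∂v := by
          rw [lintegral_biUnion_finset (t := fun P => P)
            ((hS.pairwiseDisjoint_stoppingCubes ℓ k).subset
              (fun P hP => (Finset.mem_filter.1 hP).1))
            (fun P hP => hm P (hFS P (Finset.mem_filter.1 hP).1))]
      _ = ∑ P ∈ F, ∫⁻ x in Q, P.indicator (fun _ => ⨍⁻ y in P, g y ∂v) x ∂v := by
          refine Finset.sum_congr rfl fun P hP => ?_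
          obtain ⟨hP, hPQ⟩ := Finset.mem_filter.1 hP
          rw [lintegral_indicator (hm P (hFS P hP)), setLIntegral_const,
            Measure.restrict_apply (hm P (hFS P hP)), Set.inter_eq_left.2 hPQ, mul_comm,
            measure_mul_setLAverage g (hv P (hFS P hP))]
      _ ≤ ∑ P ∈ stoppingCubes S ℓ k,
            ∫⁻ x in Q, P.indicator (fun _ => ⨍⁻ y in P, g y ∂v) x ∂v :=
          Finset.sum_le_sum_of_subset (Finset.filter_subset _ _)
      _ = ∫⁻ x in Q, averageOn v (stoppingCubes S ℓ k) g x ∂v := by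
          rw [← lintegral_finsetSum]
          · rfl
          · exact fun P hP => measurable_const.indicator (hm P (hFS P hP))

/-- The sets are disjoint: a point covered at a level `k' > k` is removed from the set of index `k`.
-/
lemma sum_setLIntegral_levelUnion_diff_le {S : Finset (Set X)} (hm : ∀ Q ∈ S, MeasurableSet Q)
    (ℓ : Set X → ℤ) (v : Measure X) (g : X → ℝ≥0∞) (I : Finset ℤ) :
    ∑ k ∈ I, ∫⁻ x in levelUnion S ℓ k \ upperUnion S ℓ k, g x ∂v ≤ ∫⁻ x, g x ∂v := by
  rw [← lintegral_biUnion_finset]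
  · exact setLIntegral_le_lintegral _ _
  · intro k _ k' _ hne
    wlog h : k < k' generalizing k k'
    · exact (this (by assumption) (by assumption) hne.symm
        (lt_of_le_of_ne (not_lt.1 h) hne.symm)).symm
    refine Set.disjoint_left.2 fun x hx hx' => hx.2 ?_
    obtain ⟨Q, hQ, hQk, hxQ⟩ := mem_levelUnion.1 hx'.1
    exact mem_upperUnion.2 ⟨Q, hQ, hQk ▸ h, hxQ⟩
  · exact fun k _ => (measurableSet_levelUnion hm ℓ k).diff (measurableSet_upperUnion hm ℓ k)

/-! ### The bilinear estimate. -/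

/-- The constant in the one-sided bilinear estimate. -/
noncomputable def bilinearConst (p q : ℝ) : ℝ≥0∞ :=
  2 * geomConst (p - 1) * (1 + (2 ^ p * geomConst (p - 1) ^ p) ^ (1 / q))

lemma bilinearConst_ne_top {p q : ℝ} (hpq : p.HolderConjugate q) : bilinearConst p q ≠ ∞ := by
  have hc : geomConst (p - 1) ≠ ∞ := geomConst_ne_top (by linarith [hpq.lt])
  have hp := hpq.nonneg
  have hq : 0 ≤ 1 / q := one_div_nonneg.2 hpq.symm.nonneg
  refine ENNReal.mul_ne_top (ENNReal.mul_ne_top (by norm_num) hc)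
    (ENNReal.add_ne_top.2 ⟨by norm_num, ?_⟩)
  exact ENNReal.rpow_ne_top_of_nonneg hq (ENNReal.mul_ne_top (by simp)
    (ENNReal.rpow_ne_top_of_nonneg hp hc))

/-- The one-sided bilinear estimate, on cubes where the averages of `f` dominate those of `g`. -/
theorem sum_mul_setLIntegral_le_of_dominated {S : Finset (Set X)} (hS : IsLaminar S)
    (hm : ∀ Q ∈ S, MeasurableSet Q) {s v : Measure X} (hs : ∀ Q ∈ S, s Q ≠ ∞)
    (hv : ∀ Q ∈ S, v Q ≠ ∞) {p q : ℝ} (hpq : p.HolderConjugate q) {f g : X → ℝ≥0∞}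
    (hf : Measurable f) (hg : Measurable g) (hf1 : ∫⁻ x, f x ^ p ∂s ≤ 1)
    (hg1 : ∫⁻ x, g x ^ q ∂v ≤ 1) (hf0 : ∀ Q ∈ S, ⨍⁻ x in Q, f x ∂s ≠ 0)
    (hft : ∀ Q ∈ S, ⨍⁻ x in Q, f x ∂s ≠ ∞)
    (hdom : ∀ Q ∈ S, (⨍⁻ x in Q, g x ∂v) ^ q * v Q ≤ (⨍⁻ x in Q, f x ∂s) ^ p * s Q)
    (c : Set X → ℝ≥0∞) {W : ℝ≥0∞}
    (hweak : ∀ A, MeasurableSet A → s A ≠ ∞ → ∀ h : X → ℝ≥0∞, Measurable h →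
      ∫⁻ x, h x ^ q ∂v ≠ ∞ → ∑ Q ∈ S, c Q * s (Q ∩ A) * ∫⁻ x in Q, h x ∂v ≤
        W * s A ^ (1 / p) * (∫⁻ x, h x ^ q ∂v) ^ (1 / q)) :
    ∑ Q ∈ S, c Q * (∫⁻ x in Q, f x ∂s) * ∫⁻ x in Q, g x ∂v ≤ bilinearConst p q * W := by
  classical
  have hp := hpq.pos
  have hq := hpq.symm.pos
  obtain ⟨ℓ, hℓ⟩ := exists_isLevel S _ hf0 hft
  set I := S.image ℓ with hI
  set Ω := levelUnion S ℓ with hΩ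
  set E : ℤ → Set X := fun k => Ω k \ upperUnion S ℓ k with hE
  set h : ℤ → X → ℝ≥0∞ := fun k => averageOn v (stoppingCubes S ℓ k) g with hh
  set Z := ∑ k ∈ I, 2 ^ ((k : ℝ) * p) * s (Ω k) with hZdef
  have hZ : Z ≤ geomConst (p - 1) ^ p :=
    (sum_two_rpow_mul_measure_levelUnion_le hS hm hs hf hpq hℓ I).trans
      (mul_le_of_le_one_right' hf1)
  have hΩm : ∀ k, MeasurableSet (Ω k) := measurableSet_levelUnion hm ℓ
  have hΩt : ∀ k, s (Ω k) ≠ ∞ := fun k => by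
    refine ne_top_of_le_ne_top ?_ (measure_biUnion_finset_le _ _)
    exact ENNReal.sum_ne_top.2 fun Q hQ => hs Q (Finset.mem_filter.1 hQ).1
  have hEm : ∀ k, MeasurableSet (E k) := fun k => (hΩm k).diff (measurableSet_upperUnion hm ℓ k)
  have hFS : ∀ k, ∀ P ∈ stoppingCubes S ℓ k, P ∈ S := fun k P hP =>
    (Finset.mem_filter.1 (mem_maximalCubes.1 (mem_stoppingCubes.1 hP).1).1).1
  have hhm : ∀ k, Measurable (h k) := fun k =>
    measurable_averageOn v (fun P hP => hm P (hFS k P hP)) g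
  have hEpow : ∀ k, ∫⁻ x, (E k).indicator g x ^ q ∂v = ∫⁻ x in E k, g x ^ q ∂v := by
    intro k
    rw [← lintegral_indicator (hEm k)]
    refine lintegral_congr fun x => ?_
    by_cases hx : x ∈ E k <;> simp [hx, ENNReal.zero_rpow_of_pos hq]
  have hEsum : ∑ k ∈ I, ∫⁻ x, (E k).indicator g x ^ q ∂v ≤ 1 := by
    simp_rw [hEpow]
    exact (sum_setLIntegral_levelUnion_diff_le hm ℓ v (fun x => g x ^ q) I).trans hg1
  -- Here the domination hypothesis enters: it trades averages of `g` on stopping cubes for those of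
  -- `f`, which the maximal theorem controls.
  have hhsum : ∑ k ∈ I, ∫⁻ x, h k x ^ q ∂v ≤ 2 ^ p * geomConst (p - 1) ^ p := by
    calc ∑ k ∈ I, ∫⁻ x, h k x ^ q ∂v
        = ∑ k ∈ I, ∑ P ∈ stoppingCubes S ℓ k, (⨍⁻ y in P, g y ∂v) ^ q * v P :=
          Finset.sum_congr rfl fun k _ => lintegral_averageOn_rpow v
            (fun P hP => hm P (hFS k P hP)) (hS.pairwiseDisjoint_stoppingCubes ℓ k) g hq
      _ ≤ ∑ k ∈ I, ∑ P ∈ stoppingCubes S ℓ k, (⨍⁻ y in P, f y ∂s) ^ p * s P :=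
          Finset.sum_le_sum fun k _ => Finset.sum_le_sum fun P hP => hdom P (hFS k P hP)
      _ ≤ 2 ^ p * Z := sum_stoppingCubes_le hS hm s hp hℓ
      _ ≤ _ := by gcongr
  have hEt : ∀ k ∈ I, ∫⁻ x, (E k).indicator g x ^ q ∂v ≠ ∞ := fun k hk =>
    ENNReal.sum_ne_top.1 (ne_top_of_le_ne_top (by norm_num) hEsum) k hk
  have hht : ∀ k ∈ I, ∫⁻ x, h k x ^ q ∂v ≠ ∞ := fun k hk => by
    refine ENNReal.sum_ne_top.1 (ne_top_of_le_ne_top ?_ hhsum) k hk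
    exact ENNReal.mul_ne_top (by simp) (ENNReal.rpow_ne_top_of_nonneg hp.le
      (geomConst_ne_top (by linarith [hpq.lt])))
  set b : ℤ → ℝ≥0∞ := fun k => 2 ^ (k : ℝ) * s (Ω k) ^ (1 / p) with hb
  have hbp : ∀ k, b k ^ p = 2 ^ ((k : ℝ) * p) * s (Ω k) := fun k => by
    rw [hb, ENNReal.mul_rpow_of_nonneg _ _ hp.le, ← ENNReal.rpow_mul, ← ENNReal.rpow_mul,
      one_div_mul_cancel hp.ne', ENNReal.rpow_one]
  have hholder : ∀ (φ : ℤ → ℝ≥0∞) (B : ℝ≥0∞), ∑ k ∈ I, φ k ≤ B →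
      ∑ k ∈ I, b k * φ k ^ (1 / q) ≤ geomConst (p - 1) * B ^ (1 / q) := by
    intro φ B hφ
    refine (ENNReal.inner_le_Lp_mul_Lq I b (fun k => φ k ^ (1 / q)) hpq).trans ?_
    simp only [hbp, ← ENNReal.rpow_mul, one_div_mul_cancel hq.ne', ENNReal.rpow_one]
    gcongr
    calc Z ^ (1 / p) ≤ (geomConst (p - 1) ^ p) ^ (1 / p) := by gcongr
      _ = geomConst (p - 1) := by
          rw [← ENNReal.rpow_mul, mul_one_div_cancel hp.ne', ENNReal.rpow_one]
  -- On level `k` the average of `f` is at most `2 ^ (k + 1)` and `Q ⊆ Ω k`, so the hypothesis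
  -- `hweak` applies with `A = Ω k`.
  have hlevel : ∀ k ∈ I, ∀ φ : X → ℝ≥0∞, Measurable φ → ∫⁻ x, φ x ^ q ∂v ≠ ∞ →
      ∑ Q ∈ S with ℓ Q = k, c Q * (∫⁻ x in Q, f x ∂s) * ∫⁻ x in Q, φ x ∂v ≤
        2 * W * (b k * (∫⁻ x, φ x ^ q ∂v) ^ (1 / q)) := by
    intro k _ φ hφ hφt
    calc ∑ Q ∈ S with ℓ Q = k, c Q * (∫⁻ x in Q, f x ∂s) * ∫⁻ x in Q, φ x ∂v
        ≤ ∑ Q ∈ S with ℓ Q = k,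
            2 ^ ((k : ℝ) + 1) * (c Q * s (Q ∩ Ω k) * ∫⁻ x in Q, φ x ∂v) := by
          refine Finset.sum_le_sum fun Q hQ => ?_
          obtain ⟨hQS, hQk⟩ := Finset.mem_filter.1 hQ
          have hQΩ : Q ∩ Ω k = Q := Set.inter_eq_left.2 fun x hx =>
            mem_levelUnion.2 ⟨Q, hQS, hQk, hx⟩
          have hle := hℓ.le_two_rpow Q hQS
          rw [hQk] at hle
          rw [hQΩ, ← measure_mul_setLAverage f (hs Q hQS)]
          calc c Q * (s Q * ⨍⁻ x in Q, f x ∂s) * ∫⁻ x in Q, φ x ∂v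
              ≤ c Q * (s Q * 2 ^ ((k : ℝ) + 1)) * ∫⁻ x in Q, φ x ∂v := by gcongr
            _ = _ := by ring
      _ = 2 ^ ((k : ℝ) + 1) * ∑ Q ∈ S with ℓ Q = k, c Q * s (Q ∩ Ω k) * ∫⁻ x in Q, φ x ∂v := by
          rw [Finset.mul_sum]
      _ ≤ 2 ^ ((k : ℝ) + 1) * (W * s (Ω k) ^ (1 / p) * (∫⁻ x, φ x ^ q ∂v) ^ (1 / q)) := by
          gcongr
          exact (Finset.sum_le_sum_of_subset (Finset.filter_subset _ _)).trans
            (hweak (Ω k) (hΩm k) (hΩt k) φ hφ hφt)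
      _ = _ := by
          rw [two_rpow_add, ENNReal.rpow_one, hb]
          ring
  calc ∑ Q ∈ S, c Q * (∫⁻ x in Q, f x ∂s) * ∫⁻ x in Q, g x ∂v
      = ∑ k ∈ I, ∑ Q ∈ S with ℓ Q = k, c Q * (∫⁻ x in Q, f x ∂s) * ∫⁻ x in Q, g x ∂v :=
        (Finset.sum_fiberwise_of_maps_to (fun Q hQ => Finset.mem_image_of_mem ℓ hQ) _).symm
    _ ≤ ∑ k ∈ I,
        (∑ Q ∈ S with ℓ Q = k, c Q * (∫⁻ x in Q, f x ∂s) * ∫⁻ x in Q, (E k).indicator g x ∂v +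
          ∑ Q ∈ S with ℓ Q = k, c Q * (∫⁻ x in Q, f x ∂s) * ∫⁻ x in Q, h k x ∂v) := by
        refine Finset.sum_le_sum fun k _ => ?_
        rw [← Finset.sum_add_distrib]
        refine Finset.sum_le_sum fun Q hQ => ?_
        obtain ⟨hQS, rfl⟩ := Finset.mem_filter.1 hQ
        rw [← mul_add]
        gcongr
        exact setLIntegral_le_add_averageOn hS hm hv g hℓ hQS
    _ ≤ ∑ k ∈ I, (2 * W * (b k * (∫⁻ x, (E k).indicator g x ^ q ∂v) ^ (1 / q)) +
          2 * W * (b k * (∫⁻ x, h k x ^ q ∂v) ^ (1 / q))) :=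
        Finset.sum_le_sum fun k hk => add_le_add
          (hlevel k hk _ (hg.indicator (hEm k)) (hEt k hk)) (hlevel k hk _ (hhm k) (hht k hk))
    _ = 2 * W * (∑ k ∈ I, b k * (∫⁻ x, (E k).indicator g x ^ q ∂v) ^ (1 / q)) +
          2 * W * ∑ k ∈ I, b k * (∫⁻ x, h k x ^ q ∂v) ^ (1 / q) := by
        rw [Finset.sum_add_distrib, Finset.mul_sum, Finset.mul_sum]
    _ ≤ 2 * W * (geomConst (p - 1) * 1 ^ (1 / q)) +
          2 * W * (geomConst (p - 1) * (2 ^ p * geomConst (p - 1) ^ p) ^ (1 / q)) := by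
        gcongr
        · exact hholder _ _ hEsum
        · exact hholder _ _ hhsum
    _ = bilinearConst p q * W := by
        rw [ENNReal.one_rpow, bilinearConst]
        ring

/-- The bilinear estimate: the two-weight strong type bound from the two weak type bounds. -/
theorem sum_mul_setLIntegral_le {S : Finset (Set X)} (hS : IsLaminar S)
    (hm : ∀ Q ∈ S, MeasurableSet Q) {s v : Measure X} (hs0 : ∀ Q ∈ S, s Q ≠ 0)
    (hs : ∀ Q ∈ S, s Q ≠ ∞) (hv0 : ∀ Q ∈ S, v Q ≠ 0) (hv : ∀ Q ∈ S, v Q ≠ ∞) {p q : ℝ}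
    (hpq : p.HolderConjugate q) {f g : X → ℝ≥0∞} (hf : Measurable f) (hg : Measurable g)
    (hf1 : ∫⁻ x, f x ^ p ∂s ≤ 1) (hg1 : ∫⁻ x, g x ^ q ∂v ≤ 1) (c : Set X → ℝ≥0∞) {W W' : ℝ≥0∞}
    (hweak : ∀ A, MeasurableSet A → s A ≠ ∞ → ∀ h : X → ℝ≥0∞, Measurable h →
      ∫⁻ x, h x ^ q ∂v ≠ ∞ → ∑ Q ∈ S, c Q * s (Q ∩ A) * ∫⁻ x in Q, h x ∂v ≤
        W * s A ^ (1 / p) * (∫⁻ x, h x ^ q ∂v) ^ (1 / q))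
    (hweak' : ∀ A, MeasurableSet A → v A ≠ ∞ → ∀ h : X → ℝ≥0∞, Measurable h →
      ∫⁻ x, h x ^ p ∂s ≠ ∞ → ∑ Q ∈ S, c Q * v (Q ∩ A) * ∫⁻ x in Q, h x ∂s ≤
        W' * v A ^ (1 / q) * (∫⁻ x, h x ^ p ∂s) ^ (1 / p)) :
    ∑ Q ∈ S, c Q * (∫⁻ x in Q, f x ∂s) * ∫⁻ x in Q, g x ∂v ≤
      bilinearConst p q * W + bilinearConst q p * W' := by
  classical
  have key : ∀ {s v : Measure X} (_ : ∀ Q ∈ S, s Q ≠ 0) (_ : ∀ Q ∈ S, s Q ≠ ∞)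
      (_ : ∀ Q ∈ S, v Q ≠ ∞) {p q : ℝ} (_ : p.HolderConjugate q) {f g : X → ℝ≥0∞}
      (_ : Measurable f) (_ : Measurable g) (_ : ∫⁻ x, f x ^ p ∂s ≤ 1)
      (_ : ∫⁻ x, g x ^ q ∂v ≤ 1) {W : ℝ≥0∞} (_ : ∀ A, MeasurableSet A → s A ≠ ∞ →
        ∀ h : X → ℝ≥0∞, Measurable h → ∫⁻ x, h x ^ q ∂v ≠ ∞ →
          ∑ Q ∈ S, c Q * s (Q ∩ A) * ∫⁻ x in Q, h x ∂v ≤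
            W * s A ^ (1 / p) * (∫⁻ x, h x ^ q ∂v) ^ (1 / q)),
      ∀ T ⊆ S, (∀ Q ∈ T, (⨍⁻ x in Q, g x ∂v) ^ q * v Q ≤ (⨍⁻ x in Q, f x ∂s) ^ p * s Q) →
        ∑ Q ∈ T, c Q * (∫⁻ x in Q, f x ∂s) * ∫⁻ x in Q, g x ∂v ≤ bilinearConst p q * W := by
    intro s v hs0 hs hv p q hpq f g hf hg hf1 hg1 W hweak T hTS hdom
    -- Cubes on which `f` has zero average contribute nothing, and they have no dyadic level.
    set T' := T.filter fun Q => ⨍⁻ x in Q, f x ∂s ≠ 0 with hT'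
    have hT'S : T' ⊆ S := (Finset.filter_subset _ _).trans hTS
    have hsum : ∑ Q ∈ T, c Q * (∫⁻ x in Q, f x ∂s) * ∫⁻ x in Q, g x ∂v =
        ∑ Q ∈ T', c Q * (∫⁻ x in Q, f x ∂s) * ∫⁻ x in Q, g x ∂v := by
      refine (Finset.sum_filter_of_ne fun Q hQ hne => ?_).symm
      contrapose! hne
      rw [← measure_mul_setLAverage f (hs Q (hTS hQ)), hne]
      simp
    rw [hsum]
    refine sum_mul_setLIntegral_le_of_dominated (hS.mono hT'S) (fun Q hQ => hm Q (hT'S hQ))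
      (fun Q hQ => hs Q (hT'S hQ)) (fun Q hQ => hv Q (hT'S hQ)) hpq hf hg hf1 hg1
      (fun Q hQ => (Finset.mem_filter.1 hQ).2) (fun Q hQ => ?_)
      (fun Q hQ => hdom Q (Finset.mem_filter.1 hQ).1) c
      (fun A hA hAt h hh hht => (Finset.sum_le_sum_of_subset hT'S).trans (hweak A hA hAt h hh hht))
    have hQS := hT'S hQ
    have hint : ∫⁻ x in Q, f x ∂s ≠ ∞ := by
      have := ENNReal.lintegral_mul_le_Lp_mul_Lq (s.restrict Q) hpq hf.aemeasurable
        (aemeasurable_const (b := (1 : ℝ≥0∞)))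
      simp only [Pi.mul_apply, mul_one, ENNReal.one_rpow, lintegral_const,
        Measure.restrict_apply_univ, one_mul] at this
      refine ne_top_of_le_ne_top (ENNReal.mul_ne_top ?_ ?_) this
      · refine ENNReal.rpow_ne_top_of_nonneg (one_div_nonneg.2 hpq.nonneg) ?_
        exact ne_top_of_le_ne_top ENNReal.one_ne_top
          ((setLIntegral_le_lintegral _ _).trans hf1)
      · exact ENNReal.rpow_ne_top_of_nonneg (one_div_nonneg.2 hpq.symm.nonneg) (hs Q hQS)
    rw [setLAverage_eq]
    exact ENNReal.div_ne_top hint (hs0 Q hQS)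
  rw [← Finset.sum_filter_add_sum_filter_not S
    (fun Q => (⨍⁻ x in Q, g x ∂v) ^ q * v Q ≤ (⨍⁻ x in Q, f x ∂s) ^ p * s Q)]
  refine add_le_add (key hs0 hs hv hpq hf hg hf1 hg1 hweak _ (Finset.filter_subset _ _)
    fun Q hQ => (Finset.mem_filter.1 hQ).2) ?_
  -- On the remaining cubes `g` dominates, so the same estimate is used with the two measures,
  -- functions and exponents interchanged.
  refine le_trans (le_of_eq (Finset.sum_congr rfl fun Q _ => mul_right_comm _ _ _))
    (key hv0 hv hs hpq.symm hg hf hg1 hf1 hweak' _ (Finset.filter_subset _ _)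
      fun Q hQ => (not_le.1 (Finset.mem_filter.1 hQ).2).le)

end

/-! ### From sparse operators to the bilinear estimate. -/

section

variable {X : Type*} [MeasurableSpace X]

lemma IsHomogeneousType.sigmaFinite {ρ : X → X → ℝ} {μ : Measure X} (hX : IsHomogeneousType ρ μ)
    (x₀ : X) : SigmaFinite μ := by
  refine ⟨⟨⟨fun n => qball ρ x₀ ((n : ℝ) + 1), fun _ => trivial,
    fun n => hX.ball_lt_top x₀ _ (by positivity), ?_⟩⟩⟩
  refine Set.eq_univ_of_forall fun x => ?_
  obtain ⟨n, hn⟩ := exists_nat_gt (ρ x x₀)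
  exact Set.mem_iUnion.2 ⟨n, show ρ x x₀ < (n : ℝ) + 1 by linarith⟩

/-- A countable family of measurable sets of positive finite measure, any two of which are
disjoint or nested. -/
structure IsCubeFamily (μ : Measure X) (S : Set (Set X)) : Prop where
  countable : S.Countable
  measurableSet : ∀ Q ∈ S, MeasurableSet Q
  measure_ne_zero : ∀ Q ∈ S, μ Q ≠ 0
  measure_ne_top : ∀ Q ∈ S, μ Q ≠ ∞
  nested : ∀ Q ∈ S, ∀ R ∈ S, Disjoint Q R ∨ Q ⊆ R ∨ R ⊆ Q

/-- Countability comes from sparseness: the sets `E Q` are disjoint and of positive measure in a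
σ-finite space. The balls inside and around each cube give positive and finite measure. -/
lemma IsSparseFamily.isCubeFamily {ρ : X → X → ℝ} {μ : Measure X} (hX : IsHomogeneousType ρ μ)
    [SigmaFinite μ] {D : ℤ → Set (Set X)} (hD : IsDyadicGrid ρ μ D) {S : Set (Set X)}
    (hS : IsSparseFamily μ D S) : IsCubeFamily μ S := by
  obtain ⟨C, η, -, ctr, hC, hη, -, -, -, hm, -, hnest, -, -, hball⟩ := hD
  obtain ⟨hSD, E, hE, hES⟩ := hS
  have hgen : ∀ Q ∈ S, ∃ k, Q ∈ D k := fun Q hQ => Set.mem_iUnion.1 (hSD hQ)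
  have hpos : ∀ Q ∈ S, μ Q ≠ 0 := by
    intro Q hQ
    obtain ⟨k, hk⟩ := hgen Q hQ
    exact ((hX.ball_pos _ _ (zpow_pos hη k)).trans_le (measure_mono (hball k Q hk).1)).ne'
  refine ⟨?_, ?_, hpos, ?_, ?_⟩
  · have hc := Measure.countable_meas_pos_of_disjoint_iUnion (μ := μ) (As := fun Q : S => E Q)
      (fun Q => (hES Q Q.2).1)
      (fun Q R hne => hE Q.2 R.2 fun h => hne (Subtype.ext h))
    have huniv : {Q : S | 0 < μ (E Q)} = Set.univ := by
      refine Set.eq_univ_of_forall fun Q => show 0 < μ (E Q) from pos_iff_ne_zero.2 fun h0 => ?_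
      refine hpos Q Q.2 ?_
      have := (hES Q Q.2).2.2
      rw [h0, mul_zero] at this
      exact nonpos_iff_eq_zero.1 this
    rw [huniv, Set.countable_univ_iff] at hc
    exact Set.countable_coe_iff.1 hc
  · intro Q hQ
    obtain ⟨k, hk⟩ := hgen Q hQ
    exact hm k Q hk
  · intro Q hQ
    obtain ⟨k, hk⟩ := hgen Q hQ
    exact ((measure_mono (hball k Q hk).2).trans_lt
      (hX.ball_lt_top _ _ (mul_pos hC (zpow_pos hη k)))).ne
  · intro Q hQ R hR
    obtain ⟨k, hk⟩ := hgen Q hQ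
    obtain ⟨l, hl⟩ := hgen R hR
    exact hnest k l Q hk R hl

lemma strongNorm_eq (μ : Measure X) {p : ℝ} (hp : 0 < p) (w g : X → ℝ≥0∞) :
    strongNorm μ p w g = (∫⁻ x, g x ^ p ∂μ.withDensity w) ^ (1 / p) := by
  rw [strongNorm, eLpNorm_eq_lintegral_rpow_enorm_toReal (by simpa using hp) (by simp),
    ENNReal.toReal_ofReal hp.le]
  simp

lemma strongNorm_le_one_iff (μ : Measure X) {p : ℝ} (hp : 0 < p) (w g : X → ℝ≥0∞) :
    strongNorm μ p w g ≤ 1 ↔ ∫⁻ x, g x ^ p ∂μ.withDensity w ≤ 1 := by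
  rw [strongNorm_eq μ hp]
  nth_rw 1 [← ENNReal.one_rpow (1 / p)]
  exact ENNReal.rpow_le_rpow_iff (by positivity)

lemma weakNorm_le_strongNorm (μ : Measure X) {p : ℝ} (hp : 0 < p) (w : X → ℝ≥0∞) {g : X → ℝ≥0∞}
    (hg : Measurable g) : weakNorm μ p w g ≤ strongNorm μ p w g := by
  rw [strongNorm_eq μ hp]
  refine iSup_le fun t => ?_
  have h1 : (t : ℝ≥0∞) ^ p * μ.withDensity w {x | (t : ℝ≥0∞) < g x} ≤
      ∫⁻ x, g x ^ p ∂μ.withDensity w := by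
    refine le_trans ?_ (mul_meas_ge_le_lintegral (hg.pow_const p) ((t : ℝ≥0∞) ^ p))
    gcongr
    exact fun hx => ENNReal.rpow_le_rpow (le_of_lt hx) hp.le
  have h2 := ENNReal.rpow_le_rpow h1 (one_div_nonneg.2 hp.le)
  rwa [ENNReal.mul_rpow_of_nonneg _ _ (one_div_nonneg.2 hp.le), ← ENNReal.rpow_mul,
    mul_one_div_cancel hp.ne', ENNReal.rpow_one] at h2

lemma setLAverage_mul_weight (μ : Measure X) {f w : X → ℝ≥0∞} (hf : Measurable f)
    (hw : Measurable w) {Q : Set X} (hQ : MeasurableSet Q) :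
    ⨍⁻ y in Q, f y * w y ∂μ = (μ Q)⁻¹ * ∫⁻ y in Q, f y ∂μ.withDensity w := by
  rw [setLAverage_eq, ENNReal.div_eq_inv_mul,
    setLIntegral_withDensity_eq_setLIntegral_mul μ hw hf hQ]
  simp [mul_comm]

lemma IsCubeFamily.measurable_sparseOp {μ : Measure X} {S : Set (Set X)} (hS : IsCubeFamily μ S)
    (f : X → ℝ≥0∞) : Measurable (sparseOp μ S f) := by
  have := hS.countable.to_subtype
  exact Measurable.tsum fun Q => measurable_const.indicator (hS.measurableSet Q Q.2)

/-- The bilinear form of the sparse operator. -/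
lemma IsCubeFamily.lintegral_sparseOp_mul {μ : Measure X} {S : Set (Set X)}
    (hS : IsCubeFamily μ S) (ν : Measure X) {f g w : X → ℝ≥0∞} (hf : Measurable f)
    (hg : Measurable g) (hw : Measurable w) :
    ∫⁻ x, sparseOp μ S (fun y => f y * w y) x * g x ∂ν =
      ∑' Q : S, (μ Q)⁻¹ * (∫⁻ y in Q, f y ∂μ.withDensity w) * ∫⁻ y in Q, g y ∂ν := by
  have := hS.countable.to_subtype
  simp_rw [sparseOp, ← ENNReal.tsum_mul_right]
  rw [lintegral_tsum]
  swap
  · exact fun Q => ((measurable_const.indicator (hS.measurableSet Q Q.2)).mul hg).aemeasurable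
  refine tsum_congr fun Q => ?_
  have hQ := hS.measurableSet Q Q.2
  rw [← setLAverage_mul_weight μ hf hw hQ, ← lintegral_indicator hQ,
    ← lintegral_const_mul _ (hg.indicator hQ)]
  refine lintegral_congr fun x => ?_
  by_cases hx : x ∈ (Q : Set X) <;> simp [hx]

lemma sparseOp_const_mul (μ : Measure X) (S : Set (Set X)) (c : ℝ≥0∞) {f w : X → ℝ≥0∞}
    (hf : Measurable f) (hw : Measurable w) (x : X) :
    sparseOp μ S (fun y => c * f y * w y) x = c * sparseOp μ S (fun y => f y * w y) x := by
  rw [sparseOp, sparseOp, ← ENNReal.tsum_mul_left]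
  refine tsum_congr fun Q => ?_
  by_cases hx : x ∈ (Q : Set X)
  · simp only [Set.indicator_of_mem hx, setLAverage_eq, mul_assoc]
    rw [lintegral_const_mul c (f := fun y => f y * w y) (hf.mul hw), mul_div_assoc]
  · simp [hx]

lemma weakNorm_const_mul_le (μ : Measure X) (p : ℝ) (w g : X → ℝ≥0∞) {c : ℝ≥0∞} (hc0 : c ≠ 0)
    (hct : c ≠ ∞) : weakNorm μ p w (fun x => c * g x) ≤ c * weakNorm μ p w g := by
  lift c to ℝ≥0 using hct
  have hc : c ≠ 0 := by simpa using hc0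
  refine iSup_le fun t => ?_
  have hset : {x | (t : ℝ≥0∞) < c * g x} = {x | ((t / c : ℝ≥0) : ℝ≥0∞) < g x} := by
    ext x
    rw [Set.mem_ofPred_eq, Set.mem_ofPred_eq, ENNReal.coe_div hc,
      ENNReal.div_lt_iff (Or.inl hc0) (Or.inl ENNReal.coe_ne_top), mul_comm]
  calc (t : ℝ≥0∞) * μ.withDensity w {x | (t : ℝ≥0∞) < c * g x} ^ (1 / p)
      = c * (((t / c : ℝ≥0) : ℝ≥0∞) *
          μ.withDensity w {x | ((t / c : ℝ≥0) : ℝ≥0∞) < g x} ^ (1 / p)) := by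
        rw [hset, ← mul_assoc, ← ENNReal.coe_mul, mul_div_cancel₀ _ hc]
    _ ≤ _ := by
        gcongr
        exact le_iSup (fun t : ℝ≥0 => (t : ℝ≥0∞) *
          μ.withDensity w {x | (t : ℝ≥0∞) < g x} ^ (1 / p)) (t / c)

/-- Homogeneity extends the bound from the unit ball. A function of norm zero cannot be normalised,
but then `h σ = 0` almost everywhere and the operator vanishes. -/
lemma weakNorm_sparseOp_le (μ : Measure X) (S : Set (Set X)) {p : ℝ} (hp : 0 < p)
    {u σ h : X → ℝ≥0∞} (hσ : Measurable σ) (hh : Measurable h)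
    (hfin : strongNorm μ p σ h ≠ ∞) :
    weakNorm μ p u (sparseOp μ S fun x => h x * σ x) ≤
      weakOpNorm μ S p σ u * strongNorm μ p σ h := by
  have hle : ∀ f : X → ℝ≥0∞, Measurable f → strongNorm μ p σ f ≤ 1 →
      weakNorm μ p u (sparseOp μ S fun x => f x * σ x) ≤ weakOpNorm μ S p σ u :=
    fun f hf hf1 => le_iSup₂_of_le f hf (le_iSup_of_le hf1 le_rfl)
  have hscale : ∀ N : ℝ≥0∞, N ≠ 0 → N ≠ ∞ → strongNorm μ p σ h ≤ N →
      weakNorm μ p u (sparseOp μ S fun x => h x * σ x) ≤ N * weakOpNorm μ S p σ u := by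
    intro N hN0 hNt hN
    have hm : Measurable fun x => N⁻¹ * h x := hh.const_mul _
    have h1 : strongNorm μ p σ (fun x => N⁻¹ * h x) ≤ 1 := by
      rw [strongNorm_le_one_iff μ hp]
      rw [strongNorm_eq μ hp] at hN
      have hN' := ENNReal.rpow_le_rpow hN hp.le
      rw [← ENNReal.rpow_mul, one_div_mul_cancel hp.ne', ENNReal.rpow_one] at hN'
      simp_rw [ENNReal.mul_rpow_of_nonneg _ _ hp.le]
      rw [lintegral_const_mul _ (hh.pow_const p), ENNReal.inv_rpow]
      refine (mul_le_mul_right hN' _).trans ?_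
      exact ENNReal.inv_mul_le_one _
    have heq : (sparseOp μ S fun x => h x * σ x) =
        fun x => N * sparseOp μ S (fun y => N⁻¹ * h y * σ y) x := by
      funext x
      rw [sparseOp_const_mul μ S _ hh hσ, ← mul_assoc, ENNReal.mul_inv_cancel hN0 hNt, one_mul]
    rw [heq]
    exact (weakNorm_const_mul_le μ p u _ hN0 hNt).trans (mul_le_mul_right (hle _ hm h1) _)
  rcases eq_or_ne (strongNorm μ p σ h) 0 with h0 | h0
  · have hz : ∀ᵐ x ∂μ.withDensity σ, h x = 0 := by
      rw [strongNorm_eq μ hp, ENNReal.rpow_eq_zero_iff] at h0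
      have hint : ∫⁻ x, h x ^ p ∂μ.withDensity σ = 0 := by
        rcases h0 with h0 | h0
        · exact h0.1
        · have : 0 < 1 / p := by positivity
          linarith [h0.2]
      filter_upwards [(lintegral_eq_zero_iff (hh.pow_const p)).1 hint] with x hx
      simpa [ENNReal.rpow_eq_zero_iff, hp, hp.not_gt] using hx
    have hz' : ∀ᵐ x ∂μ, h x * σ x = 0 := by
      rw [ae_withDensity_iff hσ] at hz
      filter_upwards [hz] with x hx
      by_cases hs : σ x = 0
      · simp [hs]
      · simp [hx hs]
    have hT : ∀ x, sparseOp μ S (fun y => h y * σ y) x = 0 := by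
      intro x
      simp only [sparseOp, ENNReal.tsum_eq_zero]
      intro Q
      have : ⨍⁻ y in (Q : Set X), h y * σ y ∂μ = 0 := by
        rw [setLAverage_eq, lintegral_congr_ae (ae_restrict_of_ae hz')]
        simp
      simp [this]
    simp only [weakNorm, hT]
    refine iSup_le fun t => ?_
    have : 0 < p⁻¹ := by positivity
    simp [this]
  · exact (hscale _ h0 hfin le_rfl).trans_eq (mul_comm _ _)

lemma IsWeight.sigmaFinite {μ : Measure X} [SigmaFinite μ] {w : X → ℝ≥0∞} (hw : IsWeight μ w) :
    SigmaFinite (μ.withDensity w) :=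
  SigmaFinite.withDensity_of_ne_top (hw.2.mono fun _ hx => hx.2.ne)

lemma IsWeight.withDensity_ne_zero {μ : Measure X} {w : X → ℝ≥0∞} (hw : IsWeight μ w) {Q : Set X}
    (hQ : μ Q ≠ 0) : μ.withDensity w Q ≠ 0 := fun h =>
  hQ (withDensity_absolutelyContinuous' hw.1.aemeasurable (hw.2.mono fun _ hx => hx.1.ne') h)

/-- If the weak operator norm is finite, then the weight `σ` is integrable over the cubes. -/
lemma IsCubeFamily.withDensity_ne_top {μ : Measure X} [SigmaFinite μ] {S : Set (Set X)}
    (hS : IsCubeFamily μ S) {p q : ℝ} (hpq : p.HolderConjugate q) {u σ : X → ℝ≥0∞}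
    (hu : IsWeight μ u) (hσ : IsWeight μ σ) (hN : weakOpNorm μ S p σ u ≠ ∞) {Q : Set X}
    (hQ : Q ∈ S) : μ.withDensity σ Q ≠ ∞ := by
  have := hσ.sigmaFinite
  have hq := hpq.symm.pos
  have hQm := hS.measurableSet Q hQ
  have hu0 : μ.withDensity u Q ^ (1 / p) ≠ 0 := by
    have := hpq.pos
    have h : 0 < p⁻¹ := by positivity
    simp [ENNReal.rpow_eq_zero_iff, hu.withDensity_ne_zero (hS.measure_ne_zero Q hQ), h.not_gt]
  -- The operator is at least the average of `f σ` everywhere on `Q`, so the weak bound controls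
  -- `∫_Q f dσ` by `B` for all `f` in the unit ball. Duality turns this into `σ(Q)^{1/q} ≤ B`.
  set B := μ Q * (weakOpNorm μ S p σ u / μ.withDensity u Q ^ (1 / p)) with hB
  have hBt : B ≠ ∞ := ENNReal.mul_ne_top (hS.measure_ne_top Q hQ) (ENNReal.div_ne_top hN hu0)
  have hdual : (∫⁻ x, Q.indicator (fun _ => (1 : ℝ≥0∞)) x ^ q ∂μ.withDensity σ) ^ (1 / q) ≤ B := by
    refine lintegral_rpow_le_of_forall_lintegral_mul_le _ hpq (measurable_const.indicator hQm)
      fun f hf hf1 => ?_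
    have hint : ∫⁻ x, Q.indicator (fun _ => (1 : ℝ≥0∞)) x * f x ∂μ.withDensity σ =
        μ Q * ⨍⁻ y in Q, f y * σ y ∂μ := by
      rw [setLAverage_mul_weight μ hf hσ.1 hQm, ← mul_assoc,
        ENNReal.mul_inv_cancel (hS.measure_ne_zero Q hQ) (hS.measure_ne_top Q hQ), one_mul,
        ← lintegral_indicator hQm]
      refine lintegral_congr fun x => ?_
      by_cases hx : x ∈ Q <;> simp [hx]
    rw [hint, hB]
    gcongr
    refine ENNReal.le_of_forall_nnreal_lt fun t ht => ?_
    rw [ENNReal.le_div_iff_mul_le (Or.inl hu0) (Or.inr hN)]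
    calc (t : ℝ≥0∞) * μ.withDensity u Q ^ (1 / p)
        ≤ t * μ.withDensity u {x | (t : ℝ≥0∞) <
            sparseOp μ S (fun y => f y * σ y) x} ^ (1 / p) := by
          have := hpq.pos
          gcongr
          intro x hx
          refine ht.trans_le (le_trans ?_ (ENNReal.le_tsum (⟨Q, hQ⟩ : S)))
          simp [hx]
      _ ≤ weakNorm μ p u (sparseOp μ S fun y => f y * σ y) :=
          le_iSup (fun t : ℝ≥0 => (t : ℝ≥0∞) * μ.withDensity u {x | (t : ℝ≥0∞) <
            sparseOp μ S (fun y => f y * σ y) x} ^ (1 / p)) t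
      _ ≤ weakOpNorm μ S p σ u :=
          le_iSup₂_of_le f hf (le_iSup_of_le ((strongNorm_le_one_iff μ hpq.pos σ f).2 hf1) le_rfl)
  intro htop
  have hone : ∀ x, Q.indicator (fun _ => (1 : ℝ≥0∞)) x ^ q =
      Q.indicator (fun _ => (1 : ℝ≥0∞)) x := by
    intro x
    by_cases hx : x ∈ Q <;> simp [hx, hq]
  simp_rw [hone] at hdual
  rw [lintegral_indicator hQm, setLIntegral_const, one_mul, htop,
    ENNReal.top_rpow_of_pos (by positivity)] at hdual
  exact hBt (top_le_iff.1 hdual)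

/-- The constant in Kolmogorov's inequality. -/
noncomputable def kolmogorovConst (q : ℝ) : ℝ≥0∞ := 1 + 2 * geomConst (q - 1)

lemma kolmogorovConst_ne_top {q : ℝ} (hq : 1 < q) : kolmogorovConst q ≠ ∞ :=
  ENNReal.add_ne_top.2 ⟨by norm_num, ENNReal.mul_ne_top (by norm_num)
    (geomConst_ne_top (by linarith))⟩

/-- The dual form of the weak type bound. -/
lemma IsCubeFamily.sum_le_of_weak {μ : Measure X} {S : Set (Set X)} (hS : IsCubeFamily μ S)
    {p q : ℝ} (hpq : p.HolderConjugate q) {u σ : X → ℝ≥0∞} (hu : IsWeight μ u)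
    {T : Finset (Set X)} (hT : ∀ Q ∈ T, Q ∈ S) {A : Set X} (hA : MeasurableSet A)
    (hAt : μ.withDensity σ A ≠ ∞) {h : X → ℝ≥0∞} (hh : Measurable h)
    (hht : ∫⁻ x, h x ^ q ∂μ.withDensity u ≠ ∞) :
    ∑ Q ∈ T, (μ Q)⁻¹ * μ.withDensity σ (Q ∩ A) * ∫⁻ x in Q, h x ∂μ.withDensity u ≤
      kolmogorovConst q * weakOpNorm μ S q u σ * μ.withDensity σ A ^ (1 / p) *
        (∫⁻ x, h x ^ q ∂μ.withDensity u) ^ (1 / q) := by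
  classical
  have hq := hpq.symm.pos
  have hnorm := strongNorm_eq μ hq u h
  have hfin : strongNorm μ q u h ≠ ∞ := by
    rw [hnorm]
    exact ENNReal.rpow_ne_top_of_nonneg (one_div_nonneg.2 hq.le) hht
  have hweak := weakNorm_sparseOp_le μ S hq (u := σ) hu.1 hh hfin
  -- Pairing `T^S(h u)` with `1_A` in `σ` yields the required sum, and Kolmogorov's inequality
  -- bounds this pairing by the weak norm.
  have hkol := setLIntegral_le_of_weak (μ.withDensity σ)
    (hS.measurable_sparseOp fun x => h x * u x) hAt hpq
    (fun t => (le_iSup (fun t : ℝ≥0 => (t : ℝ≥0∞) * μ.withDensity σ {x | (t : ℝ≥0∞) <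
      sparseOp μ S (fun y => h y * u y) x} ^ (1 / q)) t).trans hweak)
  calc ∑ Q ∈ T, (μ Q)⁻¹ * μ.withDensity σ (Q ∩ A) * ∫⁻ x in Q, h x ∂μ.withDensity u
      = ∑ Q ∈ T.attach, (fun Q : S => (μ Q)⁻¹ * (∫⁻ x in Q, h x ∂μ.withDensity u) *
          ∫⁻ x in Q, A.indicator (fun _ => 1) x ∂μ.withDensity σ) ⟨Q, hT Q Q.2⟩ := by
        rw [← Finset.sum_attach]
        refine Finset.sum_congr rfl fun Q _ => ?_
        beta_reduce
        rw [lintegral_indicator hA, setLIntegral_const, one_mul, Measure.restrict_apply hA,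
          Set.inter_comm A, mul_right_comm]
    _ ≤ ∑' Q : S, (μ Q)⁻¹ * (∫⁻ x in Q, h x ∂μ.withDensity u) *
          ∫⁻ x in Q, A.indicator (fun _ => 1) x ∂μ.withDensity σ := by
        rw [← Finset.sum_image (s := T.attach) (g := fun Q => (⟨Q, hT Q Q.2⟩ : S))
          (f := fun Q : S => (μ Q)⁻¹ * (∫⁻ x in Q, h x ∂μ.withDensity u) *
            ∫⁻ x in Q, A.indicator (fun _ => 1) x ∂μ.withDensity σ)
          (fun a _ b _ hab => Subtype.ext (congrArg (fun z : S => (z : Set X)) hab))]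
        exact ENNReal.sum_le_tsum _
    _ = ∫⁻ x in A, sparseOp μ S (fun y => h y * u y) x ∂μ.withDensity σ := by
        rw [← hS.lintegral_sparseOp_mul _ hh (measurable_const.indicator hA) hu.1,
          ← lintegral_indicator hA]
        refine lintegral_congr fun x => ?_
        by_cases hx : x ∈ A <;> simp [hx]
    _ ≤ _ := hkol
    _ = _ := by rw [hnorm, kolmogorovConst]; ring

/-- The strong type bound from the two weak type bounds. -/
lemma IsCubeFamily.strongOpNorm_le {μ : Measure X} [SigmaFinite μ] {S : Set (Set X)}
    (hS : IsCubeFamily μ S) {p q : ℝ} (hpq : p.HolderConjugate q) {u σ : X → ℝ≥0∞}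
    (hu : IsWeight μ u) (hσ : IsWeight μ σ) (hN : weakOpNorm μ S p σ u ≠ ∞)
    (hN' : weakOpNorm μ S q u σ ≠ ∞) :
    strongOpNorm μ S p σ u ≤
      bilinearConst p q * (kolmogorovConst q * weakOpNorm μ S q u σ) +
        bilinearConst q p * (kolmogorovConst p * weakOpNorm μ S p σ u) := by
  classical
  have := hu.sigmaFinite
  refine iSup₂_le fun f hf => iSup_le fun hf1 => ?_
  rw [strongNorm_le_one_iff μ hpq.pos] at hf1
  rw [strongNorm_eq μ hpq.pos]
  refine lintegral_rpow_le_of_forall_lintegral_mul_le _ hpq.symm (hS.measurable_sparseOp _)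
    fun g hg hg1 => ?_
  -- Passing to finite subfamilies provides maximal cubes and running maxima; the weak bounds of the
  -- whole family still apply, since all terms are non-negative.
  rw [hS.lintegral_sparseOp_mul _ hf hg hσ.1, ENNReal.tsum_eq_iSup_sum]
  refine iSup_le fun t => ?_
  set T : Finset (Set X) := t.map (Function.Embedding.subtype _) with hTdef
  have hT : ∀ Q ∈ T, Q ∈ S := by
    intro Q hQ
    obtain ⟨R, -, rfl⟩ := Finset.mem_map.1 hQ
    exact R.2
  have hsum := Finset.sum_map t (Function.Embedding.subtype (· ∈ S)) fun Q : Set X =>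
    (μ Q)⁻¹ * (∫⁻ y in Q, f y ∂μ.withDensity σ) * ∫⁻ y in Q, g y ∂μ.withDensity u
  simp only [Function.Embedding.subtype_apply] at hsum
  rw [← hsum]
  exact sum_mul_setLIntegral_le (fun Q hQ R hR => hS.nested Q (hT Q hQ) R (hT R hR))
    (fun Q hQ => hS.measurableSet Q (hT Q hQ))
    (fun Q hQ => hσ.withDensity_ne_zero (hS.measure_ne_zero Q (hT Q hQ)))
    (fun Q hQ => hS.withDensity_ne_top hpq hu hσ hN (hT Q hQ))
    (fun Q hQ => hu.withDensity_ne_zero (hS.measure_ne_zero Q (hT Q hQ)))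
    (fun Q hQ => hS.withDensity_ne_top hpq.symm hσ hu hN' (hT Q hQ))
    hpq hf hg hf1 hg1 (fun Q => (μ Q)⁻¹)
    (fun A hA hAt h hh hht => hS.sum_le_of_weak hpq hu hT hA hAt hh hht)
    (fun A hA hAt h hh hht => hS.sum_le_of_weak hpq.symm hσ hT hA hAt hh hht)

lemma IsCubeFamily.weakOpNorm_le_strongOpNorm {μ : Measure X} {S : Set (Set X)}
    (hS : IsCubeFamily μ S) {p : ℝ} (hp : 0 < p) (σ u : X → ℝ≥0∞) :
    weakOpNorm μ S p σ u ≤ strongOpNorm μ S p σ u :=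
  iSup₂_mono fun _ _ => iSup_mono fun _ =>
    weakNorm_le_strongNorm μ hp u (hS.measurable_sparseOp _)

/-- The sparse operator is self-adjoint. -/
lemma IsCubeFamily.strongOpNorm_dual_le {μ : Measure X} [SigmaFinite μ] {S : Set (Set X)}
    (hS : IsCubeFamily μ S) {p q : ℝ} (hpq : p.HolderConjugate q) {u σ : X → ℝ≥0∞}
    (hu : IsWeight μ u) (hσ : IsWeight μ σ) :
    strongOpNorm μ S q u σ ≤ strongOpNorm μ S p σ u := by
  have := hσ.sigmaFinite
  refine iSup₂_le fun g hg => iSup_le fun hg1 => ?_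
  rw [strongNorm_le_one_iff μ hpq.symm.pos] at hg1
  rw [strongNorm_eq μ hpq.symm.pos]
  refine lintegral_rpow_le_of_forall_lintegral_mul_le _ hpq (hS.measurable_sparseOp _)
    fun f hf hf1 => ?_
  calc ∫⁻ x, sparseOp μ S (fun y => g y * u y) x * f x ∂μ.withDensity σ
      = ∫⁻ x, sparseOp μ S (fun y => f y * σ y) x * g x ∂μ.withDensity u := by
        rw [hS.lintegral_sparseOp_mul _ hf hg hσ.1, hS.lintegral_sparseOp_mul _ hg hf hu.1]
        exact tsum_congr fun Q => mul_right_comm _ _ _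
    _ ≤ (∫⁻ x, sparseOp μ S (fun y => f y * σ y) x ^ p ∂μ.withDensity u) ^ (1 / p) *
          (∫⁻ x, g x ^ q ∂μ.withDensity u) ^ (1 / q) :=
        ENNReal.lintegral_mul_le_Lp_mul_Lq _ hpq (hS.measurable_sparseOp _).aemeasurable
          hg.aemeasurable
    _ ≤ strongNorm μ p u (sparseOp μ S fun y => f y * σ y) * 1 := by
        rw [strongNorm_eq μ hpq.pos]
        gcongr
        exact ENNReal.rpow_le_one hg1 (one_div_nonneg.2 hpq.symm.nonneg)
    _ ≤ strongOpNorm μ S p σ u := by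
        rw [mul_one]
        exact le_iSup₂_of_le f hf
          (le_iSup_of_le ((strongNorm_le_one_iff μ hpq.pos σ f).2 hf1) le_rfl)

end

theorem theorem3p2 {X : Type*} [MeasurableSpace X] (ρ : X → X → ℝ) (μ : Measure X)
    (hX : IsHomogeneousType ρ μ) (p p' : ℝ) (hp : p.HolderConjugate p') :
    ∃ C : ℝ≥0, ∀ (D : ℤ → Set (Set X)) (S : Set (Set X)) (u σ : X → ℝ≥0∞),
      IsDyadicGrid ρ μ D → IsSparseFamily μ D S → IsWeight μ u → IsWeight μ σ →
        strongOpNorm μ S p σ u ≤ C * (weakOpNorm μ S p σ u + weakOpNorm μ S p' u σ) ∧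
        weakOpNorm μ S p σ u + weakOpNorm μ S p' u σ ≤ C * strongOpNorm μ S p σ u := by
  set a := bilinearConst p p' * kolmogorovConst p' with ha
  set b := bilinearConst p' p * kolmogorovConst p with hb
  -- The terms `a` and `b` serve the first inequality and `2` the second; all depend only on the
  -- exponents.
  have hC : 2 + a + b ≠ ∞ := by
    refine ENNReal.add_ne_top.2 ⟨ENNReal.add_ne_top.2 ⟨by norm_num, ?_⟩, ?_⟩
    · exact ENNReal.mul_ne_top (bilinearConst_ne_top hp) (kolmogorovConst_ne_top hp.symm.lt)
    · exact ENNReal.mul_ne_top (bilinearConst_ne_top hp.symm) (kolmogorovConst_ne_top hp.lt)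
  refine ⟨(2 + a + b).toNNReal, fun D S u σ hD hS hu hσ => ?_⟩
  rw [ENNReal.coe_toNNReal hC]
  -- The centre map is total, so its value at any argument supplies a point whose balls exhaust the
  -- space.
  have hσf : SigmaFinite μ := by
    obtain ⟨-, -, -, ctr, -⟩ := hD
    exact hX.sigmaFinite (ctr 0 ∅)
  have hF := hS.isCubeFamily hX hD
  constructor
  · by_cases hN : weakOpNorm μ S p σ u + weakOpNorm μ S p' u σ = ∞
    · rw [hN, ENNReal.mul_top (by simp)]
      exact le_top
    obtain ⟨hN1, hN2⟩ := ENNReal.add_ne_top.1 hN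
    calc strongOpNorm μ S p σ u
        ≤ a * weakOpNorm μ S p' u σ + b * weakOpNorm μ S p σ u := by
          rw [ha, hb, mul_assoc, mul_assoc]
          exact hF.strongOpNorm_le hp hu hσ hN1 hN2
      _ ≤ (2 + a + b) * weakOpNorm μ S p' u σ + (2 + a + b) * weakOpNorm μ S p σ u := by
          gcongr
          · exact le_add_right le_add_self
          · exact le_add_self
      _ = _ := by ring
  · calc weakOpNorm μ S p σ u + weakOpNorm μ S p' u σ
        ≤ strongOpNorm μ S p σ u + strongOpNorm μ S p σ u :=
          add_le_add (hF.weakOpNorm_le_strongOpNorm hp.pos σ u)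
            ((hF.weakOpNorm_le_strongOpNorm hp.symm.pos u σ).trans
              (hF.strongOpNorm_dual_le hp hu hσ))
      _ = 2 * strongOpNorm μ S p σ u := (two_mul _).symm
      _ ≤ _ := by
          gcongr
          exact le_add_right le_self_add
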